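/- Let $r,T>0$, let $d,m$ be natural numbers, and let $\alpha,\beta,\delta$ be real numbers with $0<\beta,\delta\le 1$ and $0<\alpha<\min\{\tfrac12,\beta,\tfrac{\delta}{1+\delta}\}$. **Spaces.** For $a<c$, $W_0^{\alpha,\infty}(a,c;\mathbb R^d)$ is the space of measurable $f:[a,c]\to\mathbb R^d$ with $$\sup_{t\in[a,c]}\Big(|f(t)|+\int_a^t\frac{|f(t)-f(s)|}{(t-s)^{\alpha+1}}\,ds\Big)<\infty ,$$ and $C^{1-\alpha}(a,c;\mathbb R^d)$ is the space of $(1-\alpha)$-Hölder continuous functions, i.e. those with $\sup_{[a,c]}|f|+\sup_{a\le s<t\le c}|f(t)-f(s)|/(t-s)^{1-\alpha}<\infty$. $C(-r,T;\mathbb R^d)$ is the space of continuous functions $[-r,T]\to\mathbb R^d$ with the supremum norm $\|\cdot\|_{\infty(r)}$ and its Borel $\sigma$-algebra. $W_T^{1-\alpha,\infty}(0,T;\mathbb R^m)$ is the space of measurable $g:[0,T]\to\mathbb R^m$ with $$\sup_{0<s<t<T}\Big(\frac{|g(t)-g(s)|}{(t-s)^{1-\alpha}}+\int_s^t\frac{|g(u)-g(s)|}{(u-s)^{2-\alpha}}\,du\Big)<\infty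 ,$$ and $W_0^{\alpha,1}(0,T)$ is the space of measurable $f:[0,T]\to\mathbb R$ with $\int_0^T\frac{|f(s)|}{s^\alpha}ds+\int_0^T\!\int_0^s\frac{|f(s)-f(u)|}{(s-u)^{\alpha+1}}du\,ds<\infty$. **Integral.** For real-valued $g\in W_T^{1-\alpha,\infty}(0,T)$ and $f\in W_0^{\alpha,1}(0,T)$ the generalized Stieltjes integral is $$\int_0^T f\,dg=(-1)^\alpha\int_0^T D^\alpha_{0+}f(s)\,D^{1-\alpha}_{T-}g_{T-}(s)\,ds,\qquad g_{T-}(s)=g(s)-g(T-),$$ $$D^\alpha_{0+}f(s)=\frac1{\Gamma(1-\alpha)}\Big(\frac{f(s)}{s^\alpha}+\alpha\int_0^s\frac{f(s)-f(u)}{(s-u)^{\alpha+1}}du\Big),$$ $$D^{1-\alpha}_{T-}h(s)=\frac{(-1)^{1-\alpha}}{\Gamma(\alpha)}\Big(\frac{h(s)}{(T-s)^{1-\alpha}}+(1-\alpha)\int_s^T\frac{h(s)-h(u)}{(u-s)^{2-\alpha}}du\Big),$$ with $(-1)^\alpha(-1)^{1-\alpha}=-1$, and $\int_0^t f\,dg=\int_0^T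 f\mathbf 1_{(0,t)}\,dg$. For a $d\times m$ matrix-valued $f$ and an $\mathbb R^m$-valued $g$, $\big(\int_0^t f\,dg\big)_i=\sum_{j=1}^m\int_0^t f_{ij}\,dg^j$. **(H1)** $\sigma:[0,T]\times\mathbb R^d\to\mathbb R^{d\times m}$ is measurable, $\sigma(t,x)$ is differentiable in $x$, and for every $N\ge0$ there is $M_N>0$ such that, for all $s,t\in[0,T]$ and $i=1,\dots,d$: (1) $|\sigma(t,x)-\sigma(t,y)|\le M_0|x-y|$ for all $x,y\in\mathbb R^d$; (2) $|\partial_{x_i}\sigma(t,x)-\partial_{x_i}\sigma(t,y)|\le M_N|x-y|^\delta$ for all $|x|,|y|\le N$; (3) $|\sigma(t,x)-\sigma(s,x)|+|\partial_{x_i}\sigma(t,x)-\partial_{x_i}\sigma(s,x)|\le M_0|t-s|^\beta$ for all $x\in\mathbb R^d$. **(H2) with $\rho=1/\alpha$.** $b:[0,T]\times C(-r,T;\mathbb R^d)\to\mathbb R^d$ is measurable; for $t\in(0,T]$, $b(t,f)$ depends only on $\{f(s):-r\le s\le t\}$; and there is $b_0\in L^{1/\alpha}(0,T;\mathbb R)$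 and for every $N\ge0$ there is $L_N>0$ such that, for all $t\in[0,T]$: (1) $|b(t,x)-b(t,y)|\le L_N\sup_{-r\le s\le t}|x(s)-y(s)|$ whenever $\|x\|_{\infty(r)},\|y\|_{\infty(r)}\le N$; (2) $|b(t,x)|\le L_0\sup_{-r\le s\le t}|x(s)|+b_0(t)$ for all $x\in C(-r,T;\mathbb R^d)$. **Theorem.** Assume (H1) and (H2) with $\rho=1/\alpha$, let $g\in W_T^{1-\alpha,\infty}(0,T;\mathbb R^m)$ and $\eta\in W_0^{\alpha,\infty}(-r,0;\mathbb R^d)\cap C^{1-\alpha}(-r,0;\mathbb R^d)$. Then the delay equation $$x(t)=\eta(0)+\int_0^t b(s,x)\,ds+\int_0^t\sigma(s,x(s-r))\,dg_s,\quad t\in(0,T],\qquad x(t)=\eta(t),\quad t\in[-r,0],$$ has a unique solution $x\in W_0^{\alpha,\infty}(-r,T;\mathbb R^d)\cap C^{1-\alpha}(-r,T;\mathbb R^d)$. (Being a solution includes that the integrals exist: $s\mapsto b(s,x)$ is integrable on $[0,T]$, and the entries of $s\mapsto\sigma(s,x(s-r))\mathbf 1_{(0,t)}(s)$ are in $W_0^{\alpha,1}(0,T)$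 for every $t\in(0,T]$.) -/

import Mathlib

noncomputable section

namespace DelayEq

open MeasureTheory Set
open scoped ENNReal

/-- The norm `sup_{t ∈ [a,b]} ( |f(t)| + ∫_a^t |f(t) - f(s)| / (t-s)^{α+1} ds )`, with values in
`[0,∞]`, of a function on `[a,b]` (only the values of `f` on `[a,b]` matter). -/
def eNormW {E : Type*} [NormedAddCommGroup E] (α a b : ℝ) (f : ℝ → E) : ℝ≥0∞ :=
  ⨆ t ∈ Icc a b,
    (‖f t‖ₑ + ∫⁻ s in Ioo a t, ‖f t - f s‖ₑ / ENNReal.ofReal ((t - s) ^ (α + 1)))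

/-- The space `W_0^{α,∞}(a,b;E)`. -/
def MemW {E : Type*} [NormedAddCommGroup E] [MeasurableSpace E]
    (α a b : ℝ) (f : ℝ → E) : Prop :=
  (Measurable fun t : Icc a b => f t) ∧ eNormW α a b f < ∞

/-- The Hölder norm `sup_{[a,b]} |f| + sup_{a ≤ s < t ≤ b} |f(t) - f(s)| / (t-s)^μ`. -/
def eNormHolder {E : Type*} [NormedAddCommGroup E] (μ a b : ℝ) (f : ℝ → E) : ℝ≥0∞ :=
  (⨆ t ∈ Icc a b, ‖f t‖ₑ) +
    ⨆ s ∈ Icc a b, ⨆ t ∈ Ioc s b, ‖f t - f s‖ₑ / ENNReal.ofReal ((t - s) ^ μ)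

/-- The space `C^μ(a,b;E)`. -/
def MemHolder {E : Type*} [NormedAddCommGroup E] (μ a b : ℝ) (f : ℝ → E) : Prop :=
  eNormHolder μ a b f < ∞

/-- The seminorm
`sup_{0<s<t<T} ( |g(t) - g(s)| / (t-s)^{1-α} + ∫_s^t |g(u) - g(s)| / (u-s)^{2-α} du )`. -/
def eNormWT {E : Type*} [NormedAddCommGroup E] (α T : ℝ) (g : ℝ → E) : ℝ≥0∞ :=
  ⨆ s ∈ Ioo 0 T, ⨆ t ∈ Ioo s T,
    (‖g t - g s‖ₑ / ENNReal.ofReal ((t - s) ^ (1 - α)) +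
      ∫⁻ u in Ioo s t, ‖g u - g s‖ₑ / ENNReal.ofReal ((u - s) ^ (2 - α)))

/-- The space `W_T^{1-α,∞}(0,T;E)`. -/
def MemWT {E : Type*} [NormedAddCommGroup E] [MeasurableSpace E]
    (α T : ℝ) (g : ℝ → E) : Prop :=
  (Measurable fun t : Icc 0 T => g t) ∧ eNormWT α T g < ∞

/-- The norm `∫_0^T |f(s)| / s^α ds + ∫_0^T ∫_0^s |f(s) - f(u)| / (s-u)^{α+1} du ds`. -/
def eNormW1 (α T : ℝ) (f : ℝ → ℝ) : ℝ≥0∞ :=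
  (∫⁻ s in Ioo 0 T, ‖f s‖ₑ / ENNReal.ofReal (s ^ α)) +
    ∫⁻ s in Ioo 0 T, ∫⁻ u in Ioo 0 s, ‖f s - f u‖ₑ / ENNReal.ofReal ((s - u) ^ (α + 1))

/-- The space `W_0^{α,1}(0,T)`. -/
def MemW1 (α T : ℝ) (f : ℝ → ℝ) : Prop :=
  (Measurable fun t : Icc 0 T => f t) ∧ eNormW1 α T f < ∞

/-- The Weyl derivative `D^α_{0+} f`. -/
def weylLeft (α : ℝ) (f : ℝ → ℝ) (x : ℝ) : ℝ :=
  1 / Real.Gamma (1 - α) *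
    (f x / x ^ α + α * ∫ y in (0 : ℝ)..x, (f x - f y) / (x - y) ^ (α + 1))

/-- The Weyl derivative `D^γ_{T-} g`, without its conventional factor `(-1)^γ`. -/
def weylRight (γ T : ℝ) (g : ℝ → ℝ) (x : ℝ) : ℝ :=
  1 / Real.Gamma (1 - γ) *
    (g x / (T - x) ^ γ + γ * ∫ y in x..T, (g x - g y) / (y - x) ^ (γ + 1))

/-- The generalized Stieltjes integral
`∫_0^T f dg = (-1)^α ∫_0^T D^α_{0+} f (s) D^{1-α}_{T-} g_{T-} (s) ds`, where
`g_{T-}(s) = g(s) - g(T-)`. The factors `(-1)^α` and `(-1)^{1-α}` multiply to `-1`. -/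
def stieltjes (α T : ℝ) (f g : ℝ → ℝ) : ℝ :=
  -∫ s in (0 : ℝ)..T,
    weylLeft α f s * weylRight (1 - α) T (fun u => g u - Function.leftLim g T) s

/-- The indefinite integral `∫_0^t f dg = ∫_0^T f 1_{(0,t)} dg`. -/
def stieltjesTo (α T : ℝ) (f g : ℝ → ℝ) (t : ℝ) : ℝ :=
  stieltjes α T ((Ioo 0 t).indicator f) g

/-- Hypothesis (H1). A `d × m` matrix is an element of `EuclideanSpace ℝ (Fin d × Fin m)`, and
`∂_{x_i} σ(t,x)` is the derivative in the direction of the `i`-th basis vector. -/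
structure HypH1 {d m : ℕ} (T β δ : ℝ)
    (σ : ℝ → EuclideanSpace ℝ (Fin d) → EuclideanSpace ℝ (Fin d × Fin m)) : Prop where
  beta_mem : β ∈ Ioc 0 1
  delta_mem : δ ∈ Ioc 0 1
  measurable : Measurable fun p : Icc 0 T × EuclideanSpace ℝ (Fin d) => σ p.1 p.2
  differentiable : ∀ t ∈ Icc 0 T, Differentiable ℝ (σ t)
  bounds : ∃ M : ℝ → ℝ, (∀ N, 0 ≤ N → 0 < M N) ∧
    (∀ t ∈ Icc 0 T, ∀ x y, ‖σ t x - σ t y‖ ≤ M 0 * ‖x - y‖) ∧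
    (∀ N, 0 ≤ N → ∀ t ∈ Icc 0 T, ∀ x y, ‖x‖ ≤ N → ‖y‖ ≤ N → ∀ i : Fin d,
      ‖fderiv ℝ (σ t) x (EuclideanSpace.single i 1) -
        fderiv ℝ (σ t) y (EuclideanSpace.single i 1)‖ ≤ M N * ‖x - y‖ ^ δ) ∧
    (∀ t ∈ Icc 0 T, ∀ s ∈ Icc 0 T, ∀ x, ∀ i : Fin d,
      ‖σ t x - σ s x‖ +
        ‖fderiv ℝ (σ t) x (EuclideanSpace.single i 1) -
          fderiv ℝ (σ s) x (EuclideanSpace.single i 1)‖ ≤ M 0 * |t - s| ^ β)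

/-- `sup_{a ≤ s ≤ t} |z(s)|` for a continuous path `z` on `[a,b]` and `t ∈ [a,b]`. -/
def supUpTo {E : Type*} [NormedAddCommGroup E] {a b : ℝ} (t : ℝ) (z : C(Icc a b, E)) : ℝ :=
  ⨆ s : {s : Icc a b // (s : ℝ) ≤ t}, ‖z s‖

/-- Hypothesis (H2). The norm of `C(Icc (-r) T, _)` is the supremum norm, its σ-algebra is the
Borel one. -/
structure HypH2 {d : ℕ} (r T ρ : ℝ)
    (b : ℝ → C(Icc (-r) T, EuclideanSpace ℝ (Fin d)) → EuclideanSpace ℝ (Fin d)) : Prop where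
  two_le : 2 ≤ ρ
  measurable : Measurable[@Prod.instMeasurableSpace _ _ _ (borel _)]
    fun p : Icc 0 T × C(Icc (-r) T, EuclideanSpace ℝ (Fin d)) => b p.1 p.2
  causal : ∀ t ∈ Ioc 0 T, ∀ x y : C(Icc (-r) T, EuclideanSpace ℝ (Fin d)),
    (∀ s : Icc (-r) T, (s : ℝ) ≤ t → x s = y s) → b t x = b t y
  bounds : ∃ (b₀ : ℝ → ℝ) (L : ℝ → ℝ),
    MemLp b₀ (ENNReal.ofReal ρ) (volume.restrict (Icc 0 T)) ∧
    (∀ N, 0 ≤ N → 0 < L N) ∧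
    (∀ N, 0 ≤ N → ∀ t ∈ Icc 0 T, ∀ x y : C(Icc (-r) T, EuclideanSpace ℝ (Fin d)),
      ‖x‖ ≤ N → ‖y‖ ≤ N → ‖b t x - b t y‖ ≤ L N * supUpTo t (x - y)) ∧
    (∀ t ∈ Icc 0 T, ∀ x : C(Icc (-r) T, EuclideanSpace ℝ (Fin d)),
      ‖b t x‖ ≤ L 0 * supUpTo t x + b₀ t)

/-- `x` solves `x(t) = η(0) + ∫_0^t b(s,x) ds + ∫_0^t σ(s,x(s-r)) dg_s` for `t ∈ (0,T]`,
`x(t) = η(t)` for `t ∈ [-r,0]`. The first two fields say that the integrals exist. The path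
`x : [-r,T] → ℝ^d` is evaluated at real times through `Set.IccExtend`; only times in `[-r,T]`
matter. -/
structure IsSolution {d m : ℕ} {r T : ℝ} (h : -r ≤ T) (α : ℝ)
    (b : ℝ → C(Icc (-r) T, EuclideanSpace ℝ (Fin d)) → EuclideanSpace ℝ (Fin d))
    (σ : ℝ → EuclideanSpace ℝ (Fin d) → EuclideanSpace ℝ (Fin d × Fin m))
    (g : ℝ → EuclideanSpace ℝ (Fin m)) (η : ℝ → EuclideanSpace ℝ (Fin d))
    (x : C(Icc (-r) T, EuclideanSpace ℝ (Fin d))) : Prop where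
  integrable_drift : IntegrableOn (fun s => b s x) (Icc 0 T)
  memW1_diffusion : ∀ t ∈ Ioc 0 T, ∀ (i : Fin d) (j : Fin m),
    MemW1 α T ((Ioo 0 t).indicator fun s => σ s (IccExtend h x (s - r)) (i, j))
  equation : ∀ t ∈ Ioc 0 T, IccExtend h x t = η 0 + (∫ s in (0 : ℝ)..t, b s x) +
    WithLp.toLp 2 fun i => ∑ j : Fin m,
      stieltjesTo α T (fun s => σ s (IccExtend h x (s - r)) (i, j)) (fun s => g s j) t
  initial : ∀ t ∈ Icc (-r) 0, IccExtend h x t = η t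

end DelayEq

end

noncomputable section

namespace DelayEq

open MeasureTheory Set
open scoped ENNReal

/-! ### Integrals of powers -/

/-! The delay makes the rough term explicit. Up to time `(k+1)r` the integral of `σ(s, x(s-r))`
against `g` sees `x` only up to time `kr`, so once the path is known there, that integral is a known
forcing `z`. What remains is `x(t) = z(t) + ∫_0^t b(s,x) ds`, an ordinary functional equation with a
causal, locally Lipschitz drift of linear growth.

For a given continuous `z`, Picard iteration solves this equation on all of `[-r,T]`
(`HypH2.exists_forced`). Linear growth keeps the iterates in one ball, so one Lipschitz constant `l`
suffices, and the weight `exp(2lt)` turns the drift integral into a contraction with factor `1/2`.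
The same contraction, stopped at a time `τ`, gives causal uniqueness (`HypH2.eq_of_forced`).
Induction over windows of length `r` then yields existence (`exists_holderPath_solution`) and
uniqueness (`eq_of_eq_forcing`).

The induction needs the forcing to be Hölder of order `1-α` again. If `x` is, then `s ↦ σ(s,
x(s-r))` is Hölder of order `min β (1-α) > α`. The truncation of such a function to `[s,t)` has
`W_0^{α,1}` norm `O((t-s)^{1-α})` (`exists_eNormW1_indicator_le`), and integration against `g` is a
bounded functional in that norm (`exists_enorm_stieltjes_le`), because `D^{1-α} g_{T-}` is bounded
while `D^α f` is integrable. The drift integral is Hölder of order `1-α` because `b₀ ∈ L^{1/α}`.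
Finally `1-α > α` puts Hölder paths into `W_0^{α,∞}`. -/

lemma setLIntegral_comp_sub_right (F : ℝ → ℝ≥0∞) (c : ℝ) {S : Set ℝ} (hS : MeasurableSet S) :
    ∫⁻ x in (fun x => x - c) ⁻¹' S, F (x - c) = ∫⁻ x in S, F x := by
  rw [← lintegral_indicator hS, ← lintegral_sub_right_eq_self (S.indicator F) c,
    ← lintegral_indicator (show MeasurableSet ((fun x => x - c) ⁻¹' S) from
      measurable_id.sub_const c hS)]
  rfl

lemma setLIntegral_comp_sub_left (F : ℝ → ℝ≥0∞) (c : ℝ) {S : Set ℝ} (hS : MeasurableSet S) :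
    ∫⁻ x in (fun x => c - x) ⁻¹' S, F (c - x) = ∫⁻ x in S, F x := by
  rw [← lintegral_indicator hS, ← lintegral_sub_left_eq_self (S.indicator F) c,
    ← lintegral_indicator (show MeasurableSet ((fun x => c - x) ⁻¹' S) from
      measurable_id.const_sub c hS)]
  rfl

lemma one_div_ofReal_rpow {u : ℝ} (hu : 0 < u) (q : ℝ) :
    1 / ENNReal.ofReal (u ^ q) = ENNReal.ofReal (u ^ (-q)) := by
  rw [one_div, ← ENNReal.ofReal_inv_of_pos (Real.rpow_pos_of_pos hu q), Real.rpow_neg hu.le]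

lemma setLIntegral_Ioo_zero_rpow {p c : ℝ} (hp : 0 < p) (hc : 0 ≤ c) :
    ∫⁻ x in Ioo 0 c, ENNReal.ofReal (x ^ (p - 1)) = ENNReal.ofReal (c ^ p / p) := by
  have hi : IntervalIntegrable (fun x : ℝ => x ^ (p - 1)) volume 0 c :=
    intervalIntegral.intervalIntegrable_rpow' (by linarith)
  rw [← ofReal_integral_eq_lintegral_ofReal]
  · rw [restrict_Ioo_eq_restrict_Ioc, ← intervalIntegral.integral_of_le hc,
      integral_rpow (Or.inl (by linarith))]
    simp [Real.zero_rpow hp.ne']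
  · exact ((intervalIntegrable_iff_integrableOn_Ioo_of_le hc).1 hi)
  · filter_upwards [ae_restrict_mem measurableSet_Ioo] with x hx
    exact Real.rpow_nonneg hx.1.le _

lemma setLIntegral_Ioi_rpow {p c : ℝ} (hp : 0 < p) (hc : 0 < c) :
    ∫⁻ x in Ioi c, ENNReal.ofReal (x ^ (-(p + 1))) = ENNReal.ofReal (c ^ (-p) / p) := by
  rw [← ofReal_integral_eq_lintegral_ofReal]
  · rw [integral_Ioi_rpow_of_lt (by linarith) hc]
    congr 1
    have : -(p + 1) + 1 = -p := by ring
    rw [this, neg_div_neg_eq]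
  · exact integrableOn_Ioi_rpow_of_lt (by linarith) hc
  · filter_upwards [ae_restrict_mem measurableSet_Ioi] with x hx
    exact Real.rpow_nonneg (hc.trans hx).le _

lemma setLIntegral_Ioo_sub_left_rpow {p s t : ℝ} (hp : 0 < p) (hst : s ≤ t) :
    ∫⁻ x in Ioo s t, ENNReal.ofReal ((t - x) ^ (p - 1)) = ENNReal.ofReal ((t - s) ^ p / p) := by
  rw [← setLIntegral_Ioo_zero_rpow hp (sub_nonneg.2 hst),
    ← setLIntegral_comp_sub_left (fun x => ENNReal.ofReal (x ^ (p - 1))) t measurableSet_Ioo]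
  congr 2
  ext x; simp

lemma setLIntegral_Ioo_sub_right_rpow {p s t : ℝ} (hp : 0 < p) (hst : s ≤ t) :
    ∫⁻ x in Ioo s t, ENNReal.ofReal ((x - s) ^ (p - 1)) = ENNReal.ofReal ((t - s) ^ p / p) := by
  rw [← setLIntegral_Ioo_zero_rpow hp (sub_nonneg.2 hst),
    ← setLIntegral_comp_sub_right (fun x => ENNReal.ofReal (x ^ (p - 1))) s measurableSet_Ioo]
  congr 2
  ext x; simp

lemma setLIntegral_Ioo_one_div_sub_left {α s t : ℝ} (hα : α < 1) (hst : s ≤ t) :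
    ∫⁻ x in Ioo s t, 1 / ENNReal.ofReal ((t - x) ^ α) =
      ENNReal.ofReal ((t - s) ^ (1 - α) / (1 - α)) := by
  rw [← setLIntegral_Ioo_sub_left_rpow (by linarith) hst]
  refine setLIntegral_congr_fun measurableSet_Ioo fun x hx => ?_
  rw [one_div_ofReal_rpow (sub_pos.2 hx.2)]
  congr 2; ring

lemma setLIntegral_Ioo_one_div_sub_right {α s t : ℝ} (hα : α < 1) (hst : s ≤ t) :
    ∫⁻ x in Ioo s t, 1 / ENNReal.ofReal ((x - s) ^ α) =
      ENNReal.ofReal ((t - s) ^ (1 - α) / (1 - α)) := by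
  rw [← setLIntegral_Ioo_sub_right_rpow (by linarith) hst]
  refine setLIntegral_congr_fun measurableSet_Ioo fun x hx => ?_
  rw [one_div_ofReal_rpow (sub_pos.2 hx.1)]
  congr 2; ring

lemma setLIntegral_Iio_one_div_sub_left {α s x : ℝ} (hα : 0 < α) (hs : s < x) :
    ∫⁻ y in Iio s, 1 / ENNReal.ofReal ((x - y) ^ (α + 1)) =
      ENNReal.ofReal (1 / α) * (1 / ENNReal.ofReal ((x - s) ^ α)) := by
  rw [one_div_ofReal_rpow (sub_pos.2 hs), ← ENNReal.ofReal_mul (by positivity),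
    one_div_mul_eq_div, ← setLIntegral_Ioi_rpow hα (sub_pos.2 hs),
    ← setLIntegral_comp_sub_left (fun x => ENNReal.ofReal (x ^ (-(α + 1)))) x measurableSet_Ioi]
  have : (fun y => x - y) ⁻¹' Ioi (x - s) = Iio s := by ext y; simp
  rw [this]
  refine setLIntegral_congr_fun measurableSet_Iio fun y hy => ?_
  exact one_div_ofReal_rpow (sub_pos.2 (lt_trans hy hs)) _

lemma setLIntegral_Ioi_one_div_sub_right {α t y : ℝ} (hα : 0 < α) (hy : y < t) :
    ∫⁻ x in Ioi t, 1 / ENNReal.ofReal ((x - y) ^ (α + 1)) =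
      ENNReal.ofReal (1 / α) * (1 / ENNReal.ofReal ((t - y) ^ α)) := by
  rw [one_div_ofReal_rpow (sub_pos.2 hy), ← ENNReal.ofReal_mul (by positivity),
    one_div_mul_eq_div, ← setLIntegral_Ioi_rpow hα (sub_pos.2 hy),
    ← setLIntegral_comp_sub_right (fun x => ENNReal.ofReal (x ^ (-(α + 1)))) y measurableSet_Ioi]
  have : (fun x => x - y) ⁻¹' Ioi (t - y) = Ioi t := by ext y; simp
  rw [this]
  refine setLIntegral_congr_fun measurableSet_Ioi fun x hx => ?_
  exact one_div_ofReal_rpow (sub_pos.2 (lt_trans hy hx)) _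

section Truncation

/-! ### The `W_0^{α,1}` norm of a truncated Hölder function -/

lemma enorm_le_ofReal {x K : ℝ} (h : |x| ≤ K) : ‖x‖ₑ ≤ ENNReal.ofReal K := by
  rw [← ofReal_norm]
  exact ENNReal.ofReal_le_ofReal h

lemma ae_restrict_ne (S : Set ℝ) (s : ℝ) : ∀ᵐ x ∂volume.restrict S, x ≠ s :=
  ae_restrict_of_ae (compl_mem_ae_iff.2 (measure_singleton s))

/-- By Tonelli, integrating in `x` first leaves `(t-y)^{-α}/α`, which is integrable up to `t`
because `α < 1`. This is the cost of the jump that truncation creates at the right end. -/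
lemma lintegral_lintegral_one_div_sub {α s t : ℝ} (hα : 0 < α) (hα1 : α < 1) (hst : s ≤ t) :
    ∫⁻ x in Ioi t, ∫⁻ y in Ioo s t, 1 / ENNReal.ofReal ((x - y) ^ (α + 1)) =
      ENNReal.ofReal (1 / α) * ENNReal.ofReal ((t - s) ^ (1 - α) / (1 - α)) := by
  rw [lintegral_lintegral_swap, ← setLIntegral_Ioo_one_div_sub_left hα1 hst,
    ← lintegral_const_mul' _ _ ENNReal.ofReal_ne_top]
  · exact setLIntegral_congr_fun measurableSet_Ioo fun y hy =>
      setLIntegral_Ioi_one_div_sub_right hα hy.2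
  · fun_prop

variable {α γ T K : ℝ} {f : ℝ → ℝ}

/-- Left of the window nothing contributes. For `x` inside it, points `y < s` see the jump at `s`,
which costs `(x-s)^{-α}`, and the other `y` see Hölder increments of exponent `γ > α`. For `x` to
the right only `y` in the window count; that inner integral is left unevaluated so that Tonelli can
be applied to it later. -/
lemma setLIntegral_increment_indicator_le (hα : 0 < α) (hγ : α < γ)
    (hf : ∀ x ∈ Icc 0 T, |f x| ≤ K)
    (hf' : ∀ x ∈ Icc 0 T, ∀ y ∈ Icc 0 T, y ≤ x → |f x - f y| ≤ K * (x - y) ^ γ)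
    {s t x : ℝ} (hx : x ∈ Ioo 0 T) (hxs : x ≠ s) (hxt : x ≠ t) :
    ∫⁻ y in Ioo 0 x, ‖(Ico s t).indicator f x - (Ico s t).indicator f y‖ₑ /
        ENNReal.ofReal ((x - y) ^ (α + 1)) ≤
      (Ioo s t).indicator (fun x => ENNReal.ofReal K * ENNReal.ofReal (1 / α) *
          (1 / ENNReal.ofReal ((x - s) ^ α)) +
          ENNReal.ofReal K * ENNReal.ofReal (T ^ (γ - α) / (γ - α))) x +
        (Ioi t).indicator (fun x => ENNReal.ofReal K *
          ∫⁻ y in Ioo s t, 1 / ENNReal.ofReal ((x - y) ^ (α + 1))) x := by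
  have hK : 0 ≤ K := (abs_nonneg _).trans (hf x ⟨hx.1.le, hx.2.le⟩)
  rcases lt_or_gt_of_ne hxs with h | h
  · rw [setLIntegral_congr_fun (g := fun _ => 0) measurableSet_Ioo]
    · simp
    · intro y hy
      have h1 : x ∉ Ico s t := fun h' => absurd h'.1 (not_le.2 h)
      have h2 : y ∉ Ico s t := fun h' => absurd h'.1 (not_le.2 (hy.2.trans h))
      simp [h1, h2]
  rcases lt_or_gt_of_ne hxt with h' | h'
  · rw [indicator_of_mem (show x ∈ Ioo s t from ⟨h, h'⟩),
      indicator_of_notMem (show x ∉ Ioi t from not_lt.2 h'.le), add_zero]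
    calc _ ≤ ∫⁻ y in Ioo 0 x, ((Iio s).indicator
          (fun y => ENNReal.ofReal K * (1 / ENNReal.ofReal ((x - y) ^ (α + 1)))) y +
            ENNReal.ofReal K * ENNReal.ofReal ((x - y) ^ (γ - α - 1))) := by
          refine setLIntegral_mono' measurableSet_Ioo fun y hy => ?_
          have hxy : 0 < x - y := sub_pos.2 hy.2
          rw [indicator_of_mem (show x ∈ Ico s t from ⟨h.le, h'⟩)]
          rcases lt_or_ge y s with hys | hys
          · rw [indicator_of_notMem (show y ∉ Ico s t from fun h => absurd h.1 (not_le.2 hys)),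
              indicator_of_mem (show y ∈ Iio s from hys), sub_zero, mul_one_div]
            refine le_add_right ?_
            gcongr
            exact enorm_le_ofReal (hf x ⟨hx.1.le, hx.2.le⟩)
          · rw [indicator_of_mem (show y ∈ Ico s t from ⟨hys, hy.2.trans h'⟩)]
            refine le_add_left ?_
            calc _ ≤ ENNReal.ofReal (K * (x - y) ^ γ) / ENNReal.ofReal ((x - y) ^ (α + 1)) := by
                  gcongr
                  exact enorm_le_ofReal (hf' x ⟨hx.1.le, hx.2.le⟩ y
                    ⟨hy.1.le, (hy.2.trans hx.2).le⟩ hy.2.le)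
              _ = _ := by
                  rw [← ENNReal.ofReal_div_of_pos (Real.rpow_pos_of_pos hxy _),
                    ← ENNReal.ofReal_mul hK, mul_div_assoc, ← Real.rpow_sub hxy]
                  congr 3; ring
      _ ≤ _ := by
          rw [lintegral_add_left]
          · refine add_le_add ?_ ?_
            · refine (setLIntegral_le_lintegral _ _).trans ?_
              rw [lintegral_indicator measurableSet_Iio,
                lintegral_const_mul' _ _ ENNReal.ofReal_ne_top,
                setLIntegral_Iio_one_div_sub_left hα h, mul_assoc]
            · rw [lintegral_const_mul' _ _ ENNReal.ofReal_ne_top,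
                setLIntegral_Ioo_sub_left_rpow (sub_pos.2 hγ) hx.1.le]
              have h0 := hx.1
              have h1 := hx.2
              have h2 := sub_pos.2 hγ
              gcongr
              linarith
          · refine Measurable.indicator ?_ measurableSet_Iio
            fun_prop
  · rw [indicator_of_notMem (show x ∉ Ioo s t from fun h => absurd h.2 (not_lt.2 h'.le)),
      indicator_of_mem (show x ∈ Ioi t from h'), zero_add,
      ← lintegral_const_mul' _ _ ENNReal.ofReal_ne_top,
      setLIntegral_congr (Ioo_ae_eq_Ico (a := s) (b := t) (μ := volume)),
      ← lintegral_indicator measurableSet_Ico]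
    refine le_trans (setLIntegral_mono' measurableSet_Ioo fun y hy => ?_)
      (setLIntegral_le_lintegral (Ioo 0 x) _)
    rw [indicator_of_notMem (show x ∉ Ico s t from fun h => absurd h.2 (not_lt.2 h'.le)), zero_sub,
      enorm_neg]
    by_cases hyst : y ∈ Ico s t
    · rw [indicator_of_mem hyst, indicator_of_mem hyst, mul_one_div]
      gcongr
      exact enorm_le_ofReal (hf y ⟨hy.1.le, (hy.2.trans hx.2).le⟩)
    · simp [hyst]

lemma exists_eNormW1_indicator_le (hα : 0 < α) (hα1 : α < 1) (hγ : α < γ)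
    (hf : ∀ x ∈ Icc 0 T, |f x| ≤ K)
    (hf' : ∀ x ∈ Icc 0 T, ∀ y ∈ Icc 0 T, y ≤ x → |f x - f y| ≤ K * (x - y) ^ γ) :
    ∃ C : ℝ≥0∞, C ≠ ∞ ∧ ∀ s t, 0 ≤ s → s ≤ t → t ≤ T →
      eNormW1 α T ((Ico s t).indicator f) ≤ C * ENNReal.ofReal ((t - s) ^ (1 - α)) := by
  set k := ENNReal.ofReal K
  set a := ENNReal.ofReal (1 / α)
  set q := ENNReal.ofReal (1 / (1 - α))
  set c := ENNReal.ofReal (T ^ (γ - α) / (γ - α))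
  -- The four terms come from the weight `x^{-α}`, the jump at `s`, the Hölder increments inside the
  -- window, and the jump at `t`.
  refine ⟨k * q + (k * a * q + k * c * ENNReal.ofReal (T ^ α) + k * (a * q)), by finiteness,
    fun s t hs hst ht => ?_⟩
  set P := ENNReal.ofReal ((t - s) ^ (1 - α))
  have h1α : 0 < 1 - α := sub_pos.2 hα1
  have hP : ENNReal.ofReal ((t - s) ^ (1 - α) / (1 - α)) = q * P := by
    rw [← ENNReal.ofReal_mul (by positivity)]; congr 1; ring
  have hts : ENNReal.ofReal (t - s) ≤ ENNReal.ofReal (T ^ α) * P := by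
    have h0 : 0 ≤ t - s := sub_nonneg.2 hst
    rw [← ENNReal.ofReal_mul (Real.rpow_nonneg (by linarith) _)]
    refine ENNReal.ofReal_le_ofReal ?_
    calc t - s = (t - s) ^ α * (t - s) ^ (1 - α) := by
          rw [← Real.rpow_add' h0 (by simp)]; simp
      _ ≤ _ := by gcongr; linarith
  have hst' := setLIntegral_Ioo_one_div_sub_right hα1 hst
  rw [hP] at hst'
  rw [add_mul, add_mul, add_mul]
  refine add_le_add ?_ ?_
  -- Since `s ≥ 0`, the weight `x^{-α}` is at most `(x-s)^{-α}`, whose integral over the window has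
  -- the required order.
  · calc _ ≤ ∫⁻ x, (Ioo s t).indicator (fun x => k * (1 / ENNReal.ofReal ((x - s) ^ α))) x := by
          refine le_trans (lintegral_mono_ae ?_) (setLIntegral_le_lintegral (Ioo 0 T) _)
          filter_upwards [ae_restrict_mem measurableSet_Ioo, ae_restrict_ne _ s] with x hx hxs
          by_cases h : x ∈ Ico s t
          · have hsx : s < x := lt_of_le_of_ne h.1 hxs.symm
            rw [indicator_of_mem h, indicator_of_mem (show x ∈ Ioo s t from ⟨hsx, h.2⟩),
              mul_one_div]
            have := sub_pos.2 hsx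
            gcongr
            · exact enorm_le_ofReal (hf x ⟨hx.1.le, hx.2.le⟩)
            · linarith
          · simp [h]
      _ = _ := by
          rw [lintegral_indicator measurableSet_Ioo,
            lintegral_const_mul' _ _ ENNReal.ofReal_ne_top, hst', mul_assoc]
  · calc _ ≤ ∫⁻ x, ((Ioo s t).indicator (fun x => k * a *
          (1 / ENNReal.ofReal ((x - s) ^ α)) + k * c) x +
        (Ioi t).indicator (fun x => k *
          ∫⁻ y in Ioo s t, 1 / ENNReal.ofReal ((x - y) ^ (α + 1))) x) := by
          refine le_trans (lintegral_mono_ae ?_) (setLIntegral_le_lintegral (Ioo 0 T) _)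
          filter_upwards [ae_restrict_mem measurableSet_Ioo, ae_restrict_ne _ s,
            ae_restrict_ne _ t] with x hx hxs hxt
          exact setLIntegral_increment_indicator_le hα hγ hf hf' hx hxs hxt
      _ = k * a * (q * P) + k * c * ENNReal.ofReal (t - s) + k * (a * (q * P)) := by
          rw [lintegral_add_left, lintegral_indicator measurableSet_Ioo,
            lintegral_indicator measurableSet_Ioi, lintegral_add_right _ measurable_const,
            lintegral_const_mul' _ _ (by finiteness), hst',
            setLIntegral_const, Real.volume_Ioo, lintegral_const_mul' _ _ ENNReal.ofReal_ne_top,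
            lintegral_lintegral_one_div_sub hα hα1 hst, hP]
          · refine Measurable.indicator ?_ measurableSet_Ioo
            fun_prop
      _ ≤ k * a * (q * P) + k * c * (ENNReal.ofReal (T ^ α) * P) + k * (a * (q * P)) := by
          gcongr
      _ = _ := by ring

end Truncation

section Stieltjes

/-! ### The generalized Stieltjes integral -/

lemma measurable_indicator_of_subtype {E : Type*} [MeasurableSpace E] [Zero E] {S : Set ℝ}
    (hS : MeasurableSet S) {f : ℝ → E} (hf : Measurable fun t : S => f t) :
    Measurable (S.indicator f) := by
  refine measurable_of_restrict_of_restrict_compl hS ?_ ?_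
  · convert hf using 1
    ext x; exact indicator_of_mem x.2 f
  · convert measurable_const (a := (0 : E)) using 1
    ext x; exact indicator_of_notMem x.2 f

lemma uniformContinuousOn_of_norm_sub_le {E : Type*} [NormedAddCommGroup E] {f : ℝ → E}
    {S : Set ℝ} {C μ : ℝ} (hμ : 0 < μ) (hC : 0 ≤ C)
    (hf : ∀ s ∈ S, ∀ t ∈ S, s ≤ t → ‖f t - f s‖ ≤ C * (t - s) ^ μ) :
    UniformContinuousOn f S := by
  have key : ∀ x ∈ S, ∀ y ∈ S, x ≤ y → edist (f x) (f y) ≤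
      (C.toNNReal : ℝ≥0∞) * edist x y ^ (μ.toNNReal : ℝ) := by
    intro x hx y hy hxy
    have h := sub_nonneg.2 hxy
    rw [edist_dist, edist_dist, dist_comm, dist_comm x, dist_eq_norm, Real.dist_eq,
      abs_of_nonneg h, Real.coe_toNNReal _ hμ.le, ENNReal.ofReal_rpow_of_nonneg h hμ.le,
      ← ENNReal.ofReal_coe_nnreal, Real.coe_toNNReal _ hC, ← ENNReal.ofReal_mul hC]
    exact ENNReal.ofReal_le_ofReal (hf x hx y hy hxy)
  have hH : HolderOnWith C.toNNReal μ.toNNReal f S := by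
    intro x hx y hy
    rcases le_total x y with h | h
    · exact key x hx y hy h
    · rw [edist_comm, edist_comm x]
      exact key y hy x hx h
  exact hH.uniformContinuousOn (Real.toNNReal_pos.2 hμ)

lemma intervalIntegral_eq_Ioo {a b : ℝ} (h : a ≤ b) (f : ℝ → ℝ) :
    ∫ x in a..b, f x = ∫ x in Ioo a b, f x := by
  rw [intervalIntegral.integral_of_le h, integral_Ioc_eq_integral_Ioo]

lemma enorm_intervalIntegral_le {a b : ℝ} (h : a ≤ b) (f : ℝ → ℝ) :
    ‖∫ x in a..b, f x‖ₑ ≤ ∫⁻ x in Ioo a b, ‖f x‖ₑ := by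
  rw [intervalIntegral_eq_Ioo h]
  exact enorm_integral_le_lintegral_enorm _

lemma enorm_div_rpow {x u q : ℝ} (hu : 0 < u) :
    ‖x / u ^ q‖ₑ = ‖x‖ₑ / ENNReal.ofReal (u ^ q) := by
  have h := Real.rpow_pos_of_pos hu q
  rw [← ofReal_norm, ← ofReal_norm, norm_div, Real.norm_of_nonneg h.le,
    ENNReal.ofReal_div_of_pos h]

/-- Cutting the integrand off to a triangle turns the variable limit into an integral over the whole
line, to which the measurability part of Fubini applies. -/
lemma aestronglyMeasurable_intervalIntegral_fst {T : ℝ} {F : ℝ → ℝ → ℝ}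
    (hF : Measurable (Function.uncurry F)) :
    AEStronglyMeasurable (fun x => ∫ y in (0 : ℝ)..x, F x y) (volume.restrict (Ioo 0 T)) := by
  have hS : MeasurableSet {p : ℝ × ℝ | p.2 ∈ Ioo 0 p.1} :=
    (measurableSet_lt measurable_const measurable_snd).inter
      (measurableSet_lt measurable_snd measurable_fst)
  have h := ((hF.indicator hS).stronglyMeasurable.integral_prod_right' (ν := volume))
  refine h.aestronglyMeasurable.congr ?_
  filter_upwards [ae_restrict_mem measurableSet_Ioo] with x hx
  rw [intervalIntegral_eq_Ioo hx.1.le, ← integral_indicator measurableSet_Ioo]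
  rfl

lemma aestronglyMeasurable_intervalIntegral_snd {T : ℝ} {F : ℝ → ℝ → ℝ}
    (hF : Measurable (Function.uncurry F)) :
    AEStronglyMeasurable (fun x => ∫ y in x..T, F x y) (volume.restrict (Ioo 0 T)) := by
  have hS : MeasurableSet {p : ℝ × ℝ | p.2 ∈ Ioo p.1 T} :=
    (measurableSet_lt measurable_fst measurable_snd).inter
      (measurableSet_lt measurable_snd measurable_const)
  have h := ((hF.indicator hS).stronglyMeasurable.integral_prod_right' (ν := volume))
  refine h.aestronglyMeasurable.congr ?_
  filter_upwards [ae_restrict_mem measurableSet_Ioo] with x hx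
  rw [intervalIntegral_eq_Ioo hx.2.le, ← integral_indicator measurableSet_Ioo]
  rfl

variable {α T : ℝ}

/-! #### The left derivative -/

lemma weylLeft_congr {f f' : ℝ → ℝ} (h : EqOn f f' (Ioo 0 T)) :
    EqOn (weylLeft α f) (weylLeft α f') (Ioo 0 T) := by
  intro x hx
  unfold weylLeft
  rw [intervalIntegral_eq_Ioo hx.1.le, intervalIntegral_eq_Ioo hx.1.le, h hx]
  congr 3
  refine setIntegral_congr_fun measurableSet_Ioo fun y hy => ?_
  simp only [h ⟨hy.1, hy.2.trans hx.2⟩]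

lemma aestronglyMeasurable_weylLeft {f : ℝ → ℝ} (hf : Measurable f) :
    AEStronglyMeasurable (weylLeft α f) (volume.restrict (Ioo 0 T)) := by
  unfold weylLeft
  refine ((Measurable.aestronglyMeasurable (by fun_prop)).add
    ((aestronglyMeasurable_intervalIntegral_fst ?_).const_mul _)).const_mul _
  unfold Function.uncurry
  fun_prop

lemma enorm_weylLeft_le (hα : 0 < α) (hα1 : α < 1) (f : ℝ → ℝ) {x : ℝ} (hx : 0 < x) :
    ‖weylLeft α f x‖ₑ ≤ ENNReal.ofReal (1 / Real.Gamma (1 - α)) *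
      (‖f x‖ₑ / ENNReal.ofReal (x ^ α) +
        ∫⁻ y in Ioo 0 x, ‖f x - f y‖ₑ / ENNReal.ofReal ((x - y) ^ (α + 1))) := by
  have hΓ := Real.Gamma_pos_of_pos (sub_pos.2 hα1)
  have h1 : ‖α‖ₑ ≤ 1 := by
    simpa using enorm_le_ofReal (x := α) (K := 1) (by rw [abs_of_pos hα]; exact hα1.le)
  unfold weylLeft
  rw [enorm_mul]
  refine mul_le_mul' (enorm_le_ofReal (abs_of_pos (by positivity)).le)
    ((enorm_add_le _ _).trans ?_)
  rw [enorm_div_rpow hx, enorm_mul]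
  gcongr
  refine (mul_le_of_le_one_left' h1).trans ((enorm_intervalIntegral_le hx.le _).trans ?_)
  exact (setLIntegral_congr_fun measurableSet_Ioo
    fun y hy => enorm_div_rpow (sub_pos.2 hy.2)).le

lemma measurable_setLIntegral_increment {f : ℝ → ℝ} (hf : Measurable f) :
    Measurable fun x => ∫⁻ y in Ioo 0 x, ‖f x - f y‖ₑ / ENNReal.ofReal ((x - y) ^ (α + 1)) := by
  have hS : MeasurableSet {p : ℝ × ℝ | p.2 ∈ Ioo 0 p.1} :=
    (measurableSet_lt measurable_const measurable_snd).inter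
      (measurableSet_lt measurable_snd measurable_fst)
  have hF : Measurable fun p : ℝ × ℝ =>
      ‖f p.1 - f p.2‖ₑ / ENNReal.ofReal ((p.1 - p.2) ^ (α + 1)) := by fun_prop
  have h := (hF.indicator hS).lintegral_prod_right' (ν := volume)
  convert h using 2 with x
  rw [← lintegral_indicator measurableSet_Ioo]
  rfl

lemma lintegral_enorm_weylLeft_le (hα : 0 < α) (hα1 : α < 1) {f : ℝ → ℝ} (hf : Measurable f) :
    ∫⁻ x in Ioo 0 T, ‖weylLeft α f x‖ₑ ≤
      ENNReal.ofReal (1 / Real.Gamma (1 - α)) * eNormW1 α T f := by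
  refine (setLIntegral_mono' measurableSet_Ioo
    fun x hx => enorm_weylLeft_le hα hα1 f hx.1).trans ?_
  rw [lintegral_const_mul' _ _ ENNReal.ofReal_ne_top,
    lintegral_add_right _ (measurable_setLIntegral_increment hf), eNormW1]

lemma integrableOn_weylLeft (hα : 0 < α) (hα1 : α < 1) {f : ℝ → ℝ} (hf : Measurable f)
    (hf' : eNormW1 α T f < ∞) : IntegrableOn (weylLeft α f) (Ioo 0 T) :=
  ⟨aestronglyMeasurable_weylLeft hf, (lintegral_enorm_weylLeft_le hα hα1 hf).trans_lt
    (ENNReal.mul_lt_top ENNReal.ofReal_lt_top hf')⟩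

lemma ae_intervalIntegrable_increment {f : ℝ → ℝ} (hf : Measurable f)
    (hf' : eNormW1 α T f < ∞) : ∀ᵐ x ∂volume.restrict (Ioo 0 T),
      IntervalIntegrable (fun y => (f x - f y) / (x - y) ^ (α + 1)) volume 0 x := by
  have h := ae_lt_top (measurable_setLIntegral_increment (α := α) hf)
    (ne_top_of_le_ne_top hf'.ne le_add_self :
      ∫⁻ x in Ioo 0 T, _ ≠ ∞)
  filter_upwards [h, ae_restrict_mem measurableSet_Ioo] with x hx hxT
  rw [intervalIntegrable_iff_integrableOn_Ioo_of_le hxT.1.le]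
  refine ⟨Measurable.aestronglyMeasurable (by fun_prop), ?_⟩
  rw [HasFiniteIntegral]
  refine lt_of_le_of_lt (le_of_eq ?_) hx
  exact setLIntegral_congr_fun measurableSet_Ioo fun y hy => enorm_div_rpow (sub_pos.2 hy.2)

/-- Additivity holds only almost everywhere: the inner integrals must converge, and finiteness of
the double integral gives this for almost every `x`. -/
lemma weylLeft_add_ae {f f' : ℝ → ℝ} (hf : Measurable f) (hf1 : eNormW1 α T f < ∞)
    (hf' : Measurable f') (hf1' : eNormW1 α T f' < ∞) :
    ∀ᵐ x ∂volume.restrict (Ioo 0 T),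
      weylLeft α (f + f') x = weylLeft α f x + weylLeft α f' x := by
  filter_upwards [ae_intervalIntegrable_increment hf hf1,
    ae_intervalIntegrable_increment hf' hf1'] with x h h'
  have : ∀ y, ((f + f') x - (f + f') y) / (x - y) ^ (α + 1) =
      (f x - f y) / (x - y) ^ (α + 1) + (f' x - f' y) / (x - y) ^ (α + 1) := by
    intro y; simp only [Pi.add_apply]; ring
  unfold weylLeft
  simp_rw [this]
  rw [intervalIntegral.integral_add h h', Pi.add_apply]
  ring

/-! #### The right derivative -/

variable {g : ℝ → ℝ}

lemma aestronglyMeasurable_weylRight (γ : ℝ) (hg : Measurable fun t : Icc 0 T => g t) (c : ℝ) :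
    AEStronglyMeasurable (weylRight γ T fun u => g u - c) (volume.restrict (Ioo 0 T)) := by
  have hg' := measurable_indicator_of_subtype measurableSet_Icc hg
  have h : AEStronglyMeasurable (weylRight γ T fun u => (Icc 0 T).indicator g u - c)
      (volume.restrict (Ioo 0 T)) := by
    unfold weylRight
    refine ((Measurable.aestronglyMeasurable (by fun_prop)).add
      ((aestronglyMeasurable_intervalIntegral_snd ?_).const_mul _)).const_mul _
    unfold Function.uncurry
    fun_prop
  refine h.congr ?_
  filter_upwards [ae_restrict_mem measurableSet_Ioo] with x hx
  unfold weylRight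
  simp only
  rw [intervalIntegral_eq_Ioo hx.2.le, intervalIntegral_eq_Ioo hx.2.le,
    indicator_of_mem (Ioo_subset_Icc_self hx)]
  congr 3
  refine setIntegral_congr_fun measurableSet_Ioo fun y hy => ?_
  simp only [indicator_of_mem (show y ∈ Icc 0 T from ⟨(hx.1.trans hy.1).le, hy.2.le⟩)]

lemma MemWT.abs_sub_le (hg : MemWT α T g) {s t : ℝ} (hs : 0 < s) (hst : s < t) (ht : t < T) :
    |g t - g s| ≤ (eNormWT α T g).toReal * (t - s) ^ (1 - α) := by
  have hpos := Real.rpow_pos_of_pos (sub_pos.2 hst) (1 - α)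
  have h : ‖g t - g s‖ₑ / ENNReal.ofReal ((t - s) ^ (1 - α)) ≤ eNormWT α T g :=
    le_trans le_self_add (le_iSup₂_of_le s ⟨hs, hst.trans ht⟩ (le_iSup₂_of_le t ⟨hst, ht⟩ le_rfl))
  rw [ENNReal.div_le_iff (by simpa using hpos) ENNReal.ofReal_ne_top] at h
  have h' := ENNReal.toReal_mono (ENNReal.mul_ne_top hg.2.ne ENNReal.ofReal_ne_top) h
  rwa [toReal_enorm, ENNReal.toReal_mul, ENNReal.toReal_ofReal hpos.le, Real.norm_eq_abs] at h'

lemma lintegral_right_increment_le (g : ℝ → ℝ) {s : ℝ} (hs : s ∈ Ioo 0 T) :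
    ∫⁻ u in Ioo s T, ‖g u - g s‖ₑ / ENNReal.ofReal ((u - s) ^ (2 - α)) ≤ eNormWT α T g := by
  -- The seminorm only allows endpoints strictly below `T`; monotone convergence along `v n ↑ T`
  -- reaches the full interval.
  obtain ⟨v, hv, hvT, hlim⟩ := exists_seq_strictMono_tendsto T
  have hU : Ioo s T = ⋃ n, Ioo s (v n) := by
    ext x
    simp only [mem_Ioo, mem_iUnion]
    constructor
    · rintro ⟨h1, h2⟩
      obtain ⟨n, hn⟩ := (hlim.eventually (lt_mem_nhds h2)).exists
      exact ⟨n, h1, hn⟩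
    · rintro ⟨n, h1, h2⟩
      exact ⟨h1, h2.trans (hvT n)⟩
  rw [hU, setLIntegral_iUnion_of_directed _
    (Monotone.directed_le fun a b hab => Ioo_subset_Ioo_right (hv.monotone hab))]
  refine iSup_le fun n => ?_
  rcases le_or_gt (v n) s with h | h
  · simp [Ioo_eq_empty_of_le h]
  · exact le_trans le_add_self (le_iSup₂_of_le s hs (le_iSup₂_of_le (v n) ⟨h, hvT n⟩ le_rfl))

/-- `Function.leftLim` falls back to `g T` if no limit exists. Here Hölder continuity on `(0,T)`
makes `g` uniformly continuous, so its values near `T` are Cauchy. -/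
lemma MemWT.tendsto_leftLim (hα1 : α < 1) (hT : 0 < T) (hg : MemWT α T g) :
    Filter.Tendsto g (nhdsWithin T (Iio T)) (nhds (Function.leftLim g T)) := by
  refine tendsto_leftLim_of_tendsto ?_
  rw [← cauchy_map_iff_exists_tendsto]
  have hU : UniformContinuousOn g (Ioo 0 T) := by
    refine uniformContinuousOn_of_norm_sub_le (sub_pos.2 hα1) (C := (eNormWT α T g).toReal) ENNReal.toReal_nonneg
      fun s hs t ht hst => ?_
    rcases hst.eq_or_lt with rfl | h
    · simpa using mul_nonneg ENNReal.toReal_nonneg (Real.rpow_nonneg le_rfl _)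
    · exact hg.abs_sub_le hs.1 h ht.2
  refine Cauchy.map_of_le (cauchy_nhds.mono nhdsWithin_le_nhds) hU ?_
  exact Filter.le_principal_iff.2 (Ioo_mem_nhdsLT hT)

lemma MemWT.abs_sub_leftLim_le (hα1 : α < 1) (hg : MemWT α T g) {s : ℝ} (hs : s ∈ Ioo 0 T) :
    |g s - Function.leftLim g T| ≤ (eNormWT α T g).toReal * (T - s) ^ (1 - α) := by
  have hlim := hg.tendsto_leftLim hα1 (hs.1.trans hs.2)
  rw [abs_sub_comm]
  refine le_of_tendsto (hlim.sub_const (g s)).abs ?_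
  filter_upwards [Ioo_mem_nhdsLT hs.2] with t ht
  refine (hg.abs_sub_le hs.1 ht.1 ht.2).trans ?_
  have := sub_pos.2 ht.1
  have := ht.2
  have := sub_pos.2 hα1
  gcongr

/-- Each of the two terms of the right derivative is controlled by the seminorm of `g`: the boundary
term by the Hölder part passed to the limit at `T`, the integral term by the integral part. -/
lemma MemWT.exists_enorm_weylRight_le (hα : 0 < α) (hα1 : α < 1) (hg : MemWT α T g) :
    ∃ R : ℝ≥0∞, R ≠ ∞ ∧ ∀ x ∈ Ioo 0 T,
      ‖weylRight (1 - α) T (fun u => g u - Function.leftLim g T) x‖ₑ ≤ R := by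
  refine ⟨ENNReal.ofReal (1 / Real.Gamma α) * (eNormWT α T g + eNormWT α T g), ?_, fun x hx => ?_⟩
  · have := hg.2.ne
    finiteness
  have hΓ := Real.Gamma_pos_of_pos hα
  have hxT := sub_pos.2 hx.2
  have h1 : ‖1 - α‖ₑ ≤ 1 := by
    simpa using enorm_le_ofReal (x := 1 - α) (K := 1)
      (by rw [abs_of_pos (sub_pos.2 hα1)]; linarith)
  simp only [weylRight, sub_sub_cancel, sub_sub_sub_cancel_right]
  rw [enorm_mul]
  refine mul_le_mul' (enorm_le_ofReal (abs_of_pos (by positivity)).le)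
    ((enorm_add_le _ _).trans (add_le_add ?_ ?_))
  · rw [enorm_div_rpow hxT]
    refine ENNReal.div_le_of_le_mul ?_
    rw [← ENNReal.ofReal_toReal hg.2.ne, ← ENNReal.ofReal_mul (by positivity)]
    exact enorm_le_ofReal (hg.abs_sub_leftLim_le hα1 hx)
  · rw [enorm_mul]
    refine (mul_le_of_le_one_left' h1).trans ((enorm_intervalIntegral_le hx.2.le _).trans
      (le_trans (le_of_eq ?_) (lintegral_right_increment_le g hx)))
    refine setLIntegral_congr_fun measurableSet_Ioo fun y hy => ?_
    rw [enorm_div_rpow (sub_pos.2 hy.1), enorm_sub_rev]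
    congr 3; ring

/-! #### The integral -/

lemma stieltjes_congr (hT : 0 ≤ T) {f f' : ℝ → ℝ} (h : EqOn f f' (Ioo 0 T)) (g : ℝ → ℝ) :
    stieltjes α T f g = stieltjes α T f' g := by
  unfold stieltjes
  rw [intervalIntegral_eq_Ioo hT, intervalIntegral_eq_Ioo hT]
  congr 1
  refine setIntegral_congr_fun measurableSet_Ioo fun x hx => ?_
  simp only [weylLeft_congr h hx]

lemma stieltjes_add (hα : 0 < α) (hα1 : α < 1) (hT : 0 ≤ T) (hg : MemWT α T g) {f f' : ℝ → ℝ}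
    (hf : Measurable f) (hf1 : eNormW1 α T f < ∞)
    (hf' : Measurable f') (hf1' : eNormW1 α T f' < ∞) :
    stieltjes α T (f + f') g = stieltjes α T f g + stieltjes α T f' g := by
  obtain ⟨R, hR, hgR⟩ := hg.exists_enorm_weylRight_le hα hα1
  have hint : ∀ {f : ℝ → ℝ}, Measurable f → eNormW1 α T f < ∞ → IntegrableOn (fun s =>
      weylLeft α f s * weylRight (1 - α) T (fun u => g u - Function.leftLim g T) s)
      (Ioo 0 T) := by
    intro f hf hf1
    refine (integrableOn_weylLeft hα hα1 hf hf1).mul_bdd (c := R.toReal)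
      (aestronglyMeasurable_weylRight _ hg.1 _) ?_
    filter_upwards [ae_restrict_mem measurableSet_Ioo] with x hx
    rw [← toReal_enorm]
    exact ENNReal.toReal_mono hR (hgR x hx)
  unfold stieltjes
  rw [intervalIntegral_eq_Ioo hT, intervalIntegral_eq_Ioo hT, intervalIntegral_eq_Ioo hT,
    ← neg_add, ← integral_add (hint hf hf1) (hint hf' hf1')]
  congr 1
  refine integral_congr_ae ?_
  filter_upwards [weylLeft_add_ae hf hf1 hf' hf1'] with x hx
  rw [hx, add_mul]

/-- This is the `L¹`–`L^∞` pairing of the left derivative of `f` with the right derivative of `g`.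
-/
lemma exists_enorm_stieltjes_le (hα : 0 < α) (hα1 : α < 1) (hT : 0 ≤ T) (hg : MemWT α T g) :
    ∃ C : ℝ≥0∞, C ≠ ∞ ∧ ∀ f : ℝ → ℝ, Measurable f →
      ‖stieltjes α T f g‖ₑ ≤ C * eNormW1 α T f := by
  obtain ⟨R, hR, hgR⟩ := hg.exists_enorm_weylRight_le hα hα1
  refine ⟨R * ENNReal.ofReal (1 / Real.Gamma (1 - α)), by finiteness, fun f hf => ?_⟩
  unfold stieltjes
  rw [enorm_neg, mul_assoc]
  refine (enorm_intervalIntegral_le hT _).trans (le_trans ?_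
    (mul_le_mul_right (lintegral_enorm_weylLeft_le hα hα1 hf) R))
  rw [← lintegral_const_mul' _ _ hR]
  refine setLIntegral_mono' measurableSet_Ioo fun x hx => ?_
  rw [enorm_mul, mul_comm]
  gcongr
  exact hgR x hx

/-- Half-open windows concatenate exactly, open ones do not. The two cut-offs can differ only at
`0`, which neither the integral nor the norm sees. -/
lemma indicator_Ioo_eqOn_indicator_Ico (f : ℝ → ℝ) (t : ℝ) :
    EqOn ((Ioo 0 t).indicator f) ((Ico 0 t).indicator f) (Ioo 0 T) := by
  intro x hx
  have : x ∈ Ioo 0 t ↔ x ∈ Ico 0 t := ⟨fun h => ⟨h.1.le, h.2⟩, fun h => ⟨hx.1, h.2⟩⟩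
  by_cases h : x ∈ Ioo 0 t
  · rw [indicator_of_mem h, indicator_of_mem (this.1 h)]
  · rw [indicator_of_notMem h, indicator_of_notMem (mt this.2 h)]

lemma eNormW1_congr {f f' : ℝ → ℝ} (h : EqOn f f' (Ioo 0 T)) :
    eNormW1 α T f = eNormW1 α T f' := by
  unfold eNormW1
  congr 1
  · exact setLIntegral_congr_fun measurableSet_Ioo fun x hx => by simp only [h hx]
  · refine setLIntegral_congr_fun measurableSet_Ioo fun x hx =>
      setLIntegral_congr_fun measurableSet_Ioo fun y hy => ?_
    simp only [h hx, h ⟨hy.1, hy.2.trans hx.2⟩]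

lemma measurable_indicator_Ico {f : ℝ → ℝ} (hf : Measurable fun t : Icc 0 T => f t) {s t : ℝ}
    (hs : 0 ≤ s) (ht : t ≤ T) : Measurable ((Ico s t).indicator f) := by
  have h := (measurable_indicator_of_subtype measurableSet_Icc hf).indicator
    (measurableSet_Ico (a := s) (b := t))
  rwa [indicator_indicator, inter_eq_left.2] at h
  exact fun x hx => ⟨hs.trans hx.1, hx.2.le.trans ht⟩

lemma memW1_indicator {γ K : ℝ} {f : ℝ → ℝ} (hα : 0 < α) (hα1 : α < 1) (hγ : α < γ)
    (hfm : Measurable fun t : Icc 0 T => f t) (hf : ∀ x ∈ Icc 0 T, |f x| ≤ K)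
    (hf' : ∀ x ∈ Icc 0 T, ∀ y ∈ Icc 0 T, y ≤ x → |f x - f y| ≤ K * (x - y) ^ γ)
    {t : ℝ} (ht : t ∈ Icc 0 T) : MemW1 α T ((Ioo 0 t).indicator f) := by
  constructor
  · have h := ((measurable_indicator_of_subtype measurableSet_Icc hfm).indicator
      (measurableSet_Ioo (a := 0) (b := t))).comp (measurable_subtype_coe (p := (· ∈ Icc 0 T)))
    rwa [indicator_indicator, inter_eq_left.2] at h
    exact fun x hx => ⟨hx.1.le, hx.2.le.trans ht.2⟩
  · obtain ⟨C, hC, h⟩ := exists_eNormW1_indicator_le hα hα1 hγ hf hf'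
    rw [eNormW1_congr (indicator_Ioo_eqOn_indicator_Ico f t)]
    exact (h 0 t le_rfl ht.1 ht.2).trans_lt (by finiteness)

/-- The indefinite integral of a Hölder function is Hölder of order `1 - α`. -/
lemma exists_abs_stieltjesTo_sub_le {γ K : ℝ} {f : ℝ → ℝ} (hα : 0 < α) (hα1 : α < 1) (hγ : α < γ)
    (hT : 0 ≤ T) (hg : MemWT α T g)
    (hfm : Measurable fun t : Icc 0 T => f t) (hf : ∀ x ∈ Icc 0 T, |f x| ≤ K)
    (hf' : ∀ x ∈ Icc 0 T, ∀ y ∈ Icc 0 T, y ≤ x → |f x - f y| ≤ K * (x - y) ^ γ) :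
    ∃ C, 0 ≤ C ∧ ∀ s t, 0 ≤ s → s ≤ t → t ≤ T →
      |stieltjesTo α T f g t - stieltjesTo α T f g s| ≤ C * (t - s) ^ (1 - α) := by
  obtain ⟨C, hC, h⟩ := exists_eNormW1_indicator_le hα hα1 hγ hf hf'
  obtain ⟨D, hD, hst⟩ := exists_enorm_stieltjes_le hα hα1 hT hg
  refine ⟨(D * C).toReal, by positivity, fun s t hs hle ht => ?_⟩
  have hfin : ∀ s t, 0 ≤ s → s ≤ t → t ≤ T → eNormW1 α T ((Ico s t).indicator f) < ∞ :=
    fun s t hs hle ht => (h s t hs hle ht).trans_lt (by finiteness)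
  -- The difference of the two indefinite integrals thereby becomes the integral of `f` truncated to
  -- `[s,t)`.
  have hsplit : (Ico 0 t).indicator f = (Ico 0 s).indicator f + (Ico s t).indicator f := by
    rw [← Ico_union_Ico_eq_Ico hs hle]
    exact indicator_union_of_disjoint Ico_disjoint_Ico_same f
  unfold stieltjesTo
  rw [stieltjes_congr hT (indicator_Ioo_eqOn_indicator_Ico f t),
    stieltjes_congr hT (indicator_Ioo_eqOn_indicator_Ico f s), hsplit,
    stieltjes_add hα hα1 hT hg (measurable_indicator_Ico hfm le_rfl (hle.trans ht))
      (hfin 0 s le_rfl hs (hle.trans ht)) (measurable_indicator_Ico hfm hs ht)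
      (hfin s t hs hle ht), add_sub_cancel_left]
  have h1 := (hst _ (measurable_indicator_Ico hfm hs ht)).trans
    (mul_le_mul_right (h s t hs hle ht) D)
  have h2 := ENNReal.toReal_mono (by finiteness) h1
  rwa [← mul_assoc, ENNReal.toReal_mul, toReal_enorm, Real.norm_eq_abs,
    ENNReal.toReal_ofReal (Real.rpow_nonneg (sub_nonneg.2 hle) _)] at h2

lemma stieltjesTo_zero (f g : ℝ → ℝ) : stieltjesTo α T f g 0 = 0 := by
  simp [stieltjesTo, stieltjes, weylLeft]

end Stieltjes

section Forced

/-! ### The equation with additive forcing -/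

/-- Nonnegativity of `C` covers an empty index set, where the real supremum is `0` by convention. -/
lemma supUpTo_le {E : Type*} [NormedAddCommGroup E] {a b t C : ℝ} {z : C(Icc a b, E)} (hC : 0 ≤ C)
    (h : ∀ s : Icc a b, (s : ℝ) ≤ t → ‖z s‖ ≤ C) : supUpTo t z ≤ C :=
  Real.iSup_le (fun s => h s.1 s.2) hC

lemma integral_mul_exp (c t : ℝ) {l : ℝ} (hl : l ≠ 0) :
    ∫ s in (0 : ℝ)..t, c * Real.exp (l * s) = c / l * (Real.exp (l * t) - 1) := by
  rw [intervalIntegral.integral_const_mul,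
    intervalIntegral.integral_comp_mul_left (fun x => Real.exp x) hl, integral_exp]
  simp only [mul_zero, Real.exp_zero, smul_eq_mul]
  ring

variable {d : ℕ} {r T ρ : ℝ}
  {b : ℝ → C(Icc (-r) T, EuclideanSpace ℝ (Fin d)) → EuclideanSpace ℝ (Fin d)}

/-- The drift integral `∫_0^{max t 0} b(s,x) ds`. -/
def driftIntegral (b : ℝ → C(Icc (-r) T, EuclideanSpace ℝ (Fin d)) → EuclideanSpace ℝ (Fin d))
    (x : C(Icc (-r) T, EuclideanSpace ℝ (Fin d))) (t : ℝ) : EuclideanSpace ℝ (Fin d) :=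
  ∫ s in (0 : ℝ)..max t 0, b s x

lemma HypH2.measurable_drift (hb : HypH2 r T ρ b)
    (x : C(Icc (-r) T, EuclideanSpace ℝ (Fin d))) : Measurable fun s : Icc 0 T => b s x := by
  let : MeasurableSpace C(Icc (-r) T, EuclideanSpace ℝ (Fin d)) := borel _
  exact hb.measurable.comp (measurable_id.prodMk measurable_const)

lemma HypH2.exists_growth (hb : HypH2 r T ρ b) : ∃ (b₀ : ℝ → ℝ) (l : ℝ), 0 < l ∧
    MemLp b₀ (ENNReal.ofReal ρ) (volume.restrict (Icc 0 T)) ∧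
    IntegrableOn b₀ (Icc 0 T) ∧
    ∀ t ∈ Icc 0 T, ∀ x : C(Icc (-r) T, EuclideanSpace ℝ (Fin d)),
      ‖b t x‖ ≤ l * supUpTo t x + |b₀ t| := by
  obtain ⟨b₀, L, h0, hL, -, hg⟩ := hb.bounds
  refine ⟨b₀, L 0, hL 0 le_rfl, h0, h0.integrable ?_, fun t ht x =>
    (hg t ht x).trans (by gcongr; exact le_abs_self _)⟩
  rw [← ENNReal.ofReal_one]
  exact ENNReal.ofReal_le_ofReal (by linarith [hb.two_le])

lemma HypH2.integrableOn_drift (hb : HypH2 r T ρ b)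
    (x : C(Icc (-r) T, EuclideanSpace ℝ (Fin d))) : IntegrableOn (fun s => b s x) (Icc 0 T) := by
  obtain ⟨b₀, l, hl, -, h0, hg⟩ := hb.exists_growth
  have hm : AEStronglyMeasurable (fun s => b s x) (volume.restrict (Icc 0 T)) :=
    (aemeasurable_restrict_of_measurable_subtype measurableSet_Icc
      (hb.measurable_drift x)).aestronglyMeasurable
  refine Integrable.mono' ((integrableOn_const (C := l * ‖x‖) (by simp)).add h0.abs) hm ?_
  filter_upwards [ae_restrict_mem measurableSet_Icc] with t ht
  refine (hg t ht x).trans ?_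
  simp only [Pi.add_apply]
  gcongr
  exact supUpTo_le (norm_nonneg _) fun s _ => x.norm_coe_le_norm s

lemma HypH2.intervalIntegrable_drift (hb : HypH2 r T ρ b)
    (x : C(Icc (-r) T, EuclideanSpace ℝ (Fin d))) {s t : ℝ} (hs : s ∈ Icc 0 T)
    (ht : t ∈ Icc 0 T) : IntervalIntegrable (fun s => b s x) volume s t :=
  ((hb.integrableOn_drift x).mono_set (uIcc_subset_Icc hs ht)).intervalIntegrable

lemma max_mem_Icc (hT : 0 ≤ T) (t : Icc (-r) T) : max (t : ℝ) 0 ∈ Icc 0 T :=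
  ⟨le_max_right _ _, max_le t.2.2 hT⟩

lemma HypH2.continuous_driftIntegral (hb : HypH2 r T ρ b) (hT : 0 ≤ T)
    (x : C(Icc (-r) T, EuclideanSpace ℝ (Fin d))) :
    Continuous fun t : Icc (-r) T => driftIntegral b x t := by
  have h := intervalIntegral.continuousOn_primitive_interval (μ := volume)
    (f := fun s => b s x) (a := 0) (b := T) (by rw [uIcc_of_le hT]; exact hb.integrableOn_drift x)
  rw [uIcc_of_le hT] at h
  exact h.comp_continuous (f := fun t : Icc (-r) T => max (t : ℝ) 0) (by fun_prop)
    (max_mem_Icc hT)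

/-- The weight is chosen so that `∫_0^t l e^{2ls} ds ≤ e^{2lt}/2`: integration halves the weighted
distance. The Lipschitz bound looks only at the past, so the estimate can be stopped at any `τ`. -/
lemma HypH2.norm_driftIntegral_sub_le (hb : HypH2 r T ρ b) (hT : 0 ≤ T)
    {x y : C(Icc (-r) T, EuclideanSpace ℝ (Fin d))} {l A τ : ℝ} (hl : 0 < l) (hA : 0 ≤ A)
    (hlip : ∀ t ∈ Icc 0 T, ‖b t x - b t y‖ ≤ l * supUpTo t (x - y))
    (h : ∀ t : Icc (-r) T, (t : ℝ) ≤ τ → ‖x t - y t‖ ≤ A * Real.exp (2 * l * t))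
    (t : Icc (-r) T) (ht : (t : ℝ) ≤ τ) :
    ‖driftIntegral b x t - driftIntegral b y t‖ ≤ A / 2 * Real.exp (2 * l * t) := by
  have h0 : (0 : ℝ) ∈ Icc 0 T := ⟨le_rfl, hT⟩
  unfold driftIntegral
  rcases le_total (t : ℝ) 0 with ht0 | ht0
  · rw [max_eq_right ht0]
    simp only [intervalIntegral.integral_same, sub_self, norm_zero]
    positivity
  rw [max_eq_left ht0, ← intervalIntegral.integral_sub
    (hb.intervalIntegrable_drift x h0 ⟨ht0, t.2.2⟩) (hb.intervalIntegrable_drift y h0 ⟨ht0, t.2.2⟩)]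
  calc _ ≤ ∫ s in (0 : ℝ)..t, l * A * Real.exp (2 * l * s) := by
        refine intervalIntegral.norm_integral_le_of_norm_le ht0 ?_
          (Continuous.intervalIntegrable (by fun_prop) _ _)
        refine Filter.Eventually.of_forall fun s hs => ?_
        refine (hlip s ⟨hs.1.le, hs.2.trans t.2.2⟩).trans ?_
        rw [mul_assoc]
        gcongr
        refine supUpTo_le (by positivity) fun u hu => ?_
        refine (h u (hu.trans (hs.2.trans ht))).trans ?_
        gcongr
    _ = A / 2 * (Real.exp (2 * l * t) - 1) := by
        rw [integral_mul_exp _ _ (by positivity)]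
        field_simp
    _ ≤ _ := by gcongr; linarith

/-- The term `-C`, left over from `∫_0^t l C e^{ls} ds`, makes the bound self-reproducing: for `C =
‖z‖ + ∫ |b₀|` it absorbs the forcing and `b₀`. -/
lemma norm_driftIntegral_le {b₀ : ℝ → ℝ} {l C : ℝ}
    (hT : 0 ≤ T) (hl : 0 < l) (hC : 0 ≤ C) (h0 : IntegrableOn b₀ (Icc 0 T))
    (hg : ∀ t ∈ Icc 0 T, ∀ x : C(Icc (-r) T, EuclideanSpace ℝ (Fin d)),
      ‖b t x‖ ≤ l * supUpTo t x + |b₀ t|)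
    {x : C(Icc (-r) T, EuclideanSpace ℝ (Fin d))}
    (hx : ∀ t : Icc (-r) T, ‖x t‖ ≤ C * Real.exp (l * max (t : ℝ) 0)) (t : Icc (-r) T) :
    ‖driftIntegral b x t‖ ≤ C * (Real.exp (l * max (t : ℝ) 0) - 1) + ∫ s in Icc 0 T, |b₀ s| := by
  have hτ := max_mem_Icc hT t
  unfold driftIntegral
  set τ := max (t : ℝ) 0
  have hi0 : IntervalIntegrable (fun s => |b₀ s|) volume 0 τ := by
    refine IntegrableOn.intervalIntegrable ?_
    rw [uIcc_of_le hτ.1]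
    exact (h0.mono_set (Icc_subset_Icc_right hτ.2)).abs
  have hi1 : IntervalIntegrable (fun s => l * C * Real.exp (l * s)) volume 0 τ :=
    Continuous.intervalIntegrable (by fun_prop) _ _
  calc _ ≤ ∫ s in (0 : ℝ)..τ, (l * C * Real.exp (l * s) + |b₀ s|) := by
        refine intervalIntegral.norm_integral_le_of_norm_le hτ.1 ?_ (hi1.add hi0)
        refine Filter.Eventually.of_forall fun s hs => ?_
        refine (hg s ⟨hs.1.le, hs.2.trans hτ.2⟩ x).trans ?_
        rw [mul_assoc]
        gcongr
        refine supUpTo_le (by positivity) fun u hu => (hx u).trans ?_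
        gcongr
        exact max_le hu hs.1.le
    _ = C * (Real.exp (l * τ) - 1) + ∫ s in (0 : ℝ)..τ, |b₀ s| := by
        rw [intervalIntegral.integral_add hi1 hi0, integral_mul_exp _ _ hl.ne']
        field_simp
    _ ≤ _ := by
        gcongr
        rw [intervalIntegral.integral_of_le hτ.1]
        refine setIntegral_mono_set h0.abs (Filter.Eventually.of_forall fun _ => abs_nonneg _) ?_
        exact (Ioc_subset_Icc_self.trans (Icc_subset_Icc_right hτ.2)).eventuallyLE

/-- Solutions with forcings that agree up to time `τ` agree up to time `τ`. -/
lemma HypH2.eq_of_forced (hb : HypH2 r T ρ b) (hT : 0 ≤ T) {τ : ℝ}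
    {x y : C(Icc (-r) T, EuclideanSpace ℝ (Fin d))} {z : ℝ → EuclideanSpace ℝ (Fin d)}
    (hx : ∀ t : Icc (-r) T, (t : ℝ) ≤ τ → x t = z t + driftIntegral b x t)
    (hy : ∀ t : Icc (-r) T, (t : ℝ) ≤ τ → y t = z t + driftIntegral b y t)
    (t : Icc (-r) T) (ht : (t : ℝ) ≤ τ) : x t = y t := by
  obtain ⟨b₀, L, -, hL, hLip, -⟩ := hb.bounds
  set N := max ‖x‖ ‖y‖
  have hN : 0 ≤ N := (norm_nonneg x).trans (le_max_left _ _)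
  have hl := hL N hN
  set l := L N
  have hlip : ∀ t ∈ Icc 0 T, ‖b t x - b t y‖ ≤ l * supUpTo t (x - y) := fun t ht =>
    hLip N hN t ht x y (le_max_left _ _) (le_max_right _ _)
  -- The factor `exp(2lr)` compensates for the weight at negative times, where `t ≥ -r`.
  set A := ‖x - y‖ * Real.exp (2 * l * r)
  have key : ∀ n : ℕ, ∀ t : Icc (-r) T, (t : ℝ) ≤ τ →
      ‖x t - y t‖ ≤ A * (1 / 2) ^ n * Real.exp (2 * l * t) := by
    intro n
    induction n with
    | zero =>
      intro t _
      rw [pow_zero, mul_one, mul_assoc, ← Real.exp_add]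
      refine ((x - y).norm_coe_le_norm t).trans (le_mul_of_one_le_right (norm_nonneg _) ?_)
      refine Real.one_le_exp ?_
      have := t.2.1
      nlinarith
    | succ n ih =>
      intro t ht
      have h := hb.norm_driftIntegral_sub_le hT hl (by positivity) hlip ih t ht
      rw [hx t ht, hy t ht, add_sub_add_left_eq_sub]
      refine h.trans (le_of_eq ?_)
      rw [pow_succ]; ring
  have hlim : Filter.Tendsto (fun n : ℕ => A * (1 / 2 : ℝ) ^ n * Real.exp (2 * l * t))
      Filter.atTop (nhds (A * 0 * Real.exp (2 * l * t))) :=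
    ((tendsto_pow_atTop_nhds_zero_of_lt_one (by norm_num) (by norm_num)).const_mul A).mul_const _
  have h0 := ge_of_tendsto' hlim fun n => key n t ht
  rw [mul_zero, zero_mul] at h0
  exact sub_eq_zero.1 (norm_le_zero_iff.1 h0)

/-- Existence for the equation with continuous forcing. -/
lemma HypH2.exists_forced (hb : HypH2 r T ρ b) (hT : 0 ≤ T)
    (z : C(Icc (-r) T, EuclideanSpace ℝ (Fin d))) :
    ∃ x : C(Icc (-r) T, EuclideanSpace ℝ (Fin d)),
      ∀ t : Icc (-r) T, x t = z t + driftIntegral b x t := by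
  obtain ⟨b₀, l₀, hl₀, -, h0, hg⟩ := hb.exists_growth
  obtain ⟨-, L, -, hL, hLip, -⟩ := hb.bounds
  have hex : ∀ x : C(Icc (-r) T, EuclideanSpace ℝ (Fin d)),
      ∃ y : C(Icc (-r) T, EuclideanSpace ℝ (Fin d)), ∀ t, y t = z t + driftIntegral b x t :=
    fun x => ⟨⟨fun t => z t + driftIntegral b x t,
      z.continuous.add (hb.continuous_driftIntegral hT x)⟩, fun t => rfl⟩
  choose Ψ hΨ using hex
  have hI : 0 ≤ ∫ s in Icc 0 T, |b₀ s| := integral_nonneg fun _ => abs_nonneg _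
  set C := ‖z‖ + ∫ s in Icc 0 T, |b₀ s|
  have hC : 0 ≤ C := by positivity
  set N := C * Real.exp (l₀ * T)
  have hN : 0 ≤ N := by positivity
  let X : ℕ → C(Icc (-r) T, EuclideanSpace ℝ (Fin d)) := fun n => Ψ^[n] z
  have hXs : ∀ n, X (n + 1) = Ψ (X n) := fun n => Function.iterate_succ_apply' Ψ n z
  have hbd : ∀ n t, ‖X n t‖ ≤ C * Real.exp (l₀ * max (t : ℝ) 0) := by
    intro n
    induction n with
    | zero =>
      intro t
      refine (z.norm_coe_le_norm t).trans (le_trans (by linarith [hI] : ‖z‖ ≤ C) ?_)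
      exact le_mul_of_one_le_right hC
        (Real.one_le_exp (mul_nonneg hl₀.le (le_max_right _ _)))
    | succ n ih =>
      intro t
      rw [hXs, hΨ]
      refine (norm_add_le _ _).trans ?_
      have h1 := norm_driftIntegral_le hT hl₀ hC h0 hg ih t
      have h2 := z.norm_coe_le_norm t
      have h3 : C = ‖z‖ + ∫ s in Icc 0 T, |b₀ s| := rfl
      linarith
  -- All iterates lie in one ball, so the Lipschitz constant `L N` serves every step although `b` is
  -- only locally Lipschitz.
  have hXN : ∀ n, ‖X n‖ ≤ N := fun n => (ContinuousMap.norm_le _ hN).2 fun t =>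
    (hbd n t).trans (by
      have := (max_mem_Icc hT t).2
      exact mul_le_mul_of_nonneg_left (by gcongr) hC)
  have hl := hL N hN
  set l := L N
  have hstep : ∀ x y : C(Icc (-r) T, EuclideanSpace ℝ (Fin d)), ‖x‖ ≤ N → ‖y‖ ≤ N → ∀ A, 0 ≤ A →
      (∀ t : Icc (-r) T, ‖x t - y t‖ ≤ A * Real.exp (2 * l * t)) → ∀ t : Icc (-r) T,
      ‖Ψ x t - Ψ y t‖ ≤ A / 2 * Real.exp (2 * l * t) := by
    intro x y hx hy A hA h t
    rw [hΨ, hΨ, add_sub_add_left_eq_sub]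
    exact hb.norm_driftIntegral_sub_le hT hl hA (fun t ht => hLip N hN t ht x y hx hy)
      (τ := T) (fun t _ => h t) t t.2.2
  have hnorm : ∀ (x y : C(Icc (-r) T, EuclideanSpace ℝ (Fin d))) (t : Icc (-r) T),
      ‖x t - y t‖ ≤ ‖x - y‖ * Real.exp (2 * l * r) * Real.exp (2 * l * t) := by
    intro x y t
    rw [mul_assoc, ← Real.exp_add]
    refine ((x - y).norm_coe_le_norm t).trans (le_mul_of_one_le_right (norm_nonneg _) ?_)
    refine Real.one_le_exp ?_
    have := t.2.1
    nlinarith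
  have hdist : ∀ (x y : C(Icc (-r) T, EuclideanSpace ℝ (Fin d))) (A : ℝ), 0 ≤ A →
      (∀ t : Icc (-r) T, ‖x t - y t‖ ≤ A * Real.exp (2 * l * t)) →
      dist x y ≤ A * Real.exp (2 * l * T) := by
    intro x y A hA h
    rw [dist_eq_norm, ContinuousMap.norm_le _ (by positivity)]
    refine fun t => (h t).trans ?_
    have := t.2.2
    gcongr
  have hcauchy : CauchySeq X := by
    set A := ‖X 0 - X 1‖ * Real.exp (2 * l * r)
    have key : ∀ n : ℕ, ∀ t : Icc (-r) T,
        ‖X n t - X (n + 1) t‖ ≤ A * (1 / 2) ^ n * Real.exp (2 * l * t) := by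
      intro n
      induction n with
      | zero => intro t; simpa [A] using hnorm (X 0) (X 1) t
      | succ n ih =>
        intro t
        have h := hstep (X n) (X (n + 1)) (hXN _) (hXN _) _ (by positivity) ih t
        rw [← hXs, ← hXs] at h
        refine h.trans (le_of_eq ?_)
        rw [pow_succ]; ring
    refine cauchySeq_of_le_geometric (1 / 2) (A * Real.exp (2 * l * T)) (by norm_num) fun n => ?_
    refine (hdist _ _ _ (by positivity) (key n)).trans (le_of_eq (by ring))
  obtain ⟨x, hx⟩ := cauchySeq_tendsto_of_complete hcauchy
  have hxN : ‖x‖ ≤ N := le_of_tendsto' hx.norm hXN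
  -- Continuity of `Ψ` is needed only along the iterates and at their limit, all of which lie in the
  -- ball of radius `N`.
  have hΨx : Filter.Tendsto (fun n => X (n + 1)) Filter.atTop (nhds (Ψ x)) := by
    rw [tendsto_iff_dist_tendsto_zero]
    have hlim : Filter.Tendsto (fun n => ‖X n - x‖ * Real.exp (2 * l * r) / 2 *
        Real.exp (2 * l * T)) Filter.atTop
        (nhds (0 * Real.exp (2 * l * r) / 2 * Real.exp (2 * l * T))) :=
      (((tendsto_iff_norm_sub_tendsto_zero.1 hx).mul_const _).div_const _).mul_const _
    simp only [zero_mul, zero_div] at hlim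
    refine squeeze_zero (fun _ => dist_nonneg) (fun n => ?_) hlim
    rw [hXs]
    exact hdist _ _ _ (by positivity)
      (hstep (X n) x (hXN n) hxN _ (by positivity) (hnorm (X n) x))
  have hfix : x = Ψ x := tendsto_nhds_unique ((Filter.tendsto_add_atTop_iff_nat 1).2 hx) hΨx
  exact ⟨x, fun t => by rw [← hΨ x t, ← hfix]⟩

/-- The drift integral is Hölder of order `1 - α`. -/
lemma HypH2.exists_norm_integral_drift_le {α : ℝ} (hα : 0 < α) (hα1 : α < 1) (hT : 0 ≤ T)
    (hb : HypH2 r T (1 / α) b) (x : C(Icc (-r) T, EuclideanSpace ℝ (Fin d))) :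
    ∃ C, 0 ≤ C ∧ ∀ s t, 0 ≤ s → s ≤ t → t ≤ T →
      ‖(∫ u in (0 : ℝ)..t, b u x) - ∫ u in (0 : ℝ)..s, b u x‖ ≤ C * (t - s) ^ (1 - α) := by
  obtain ⟨b₀, l, hl, hLp, h0, hg⟩ := hb.exists_growth
  set B := (eLpNorm b₀ (ENNReal.ofReal (1 / α)) (volume.restrict (Icc 0 T))).toReal
  refine ⟨l * ‖x‖ * T ^ α + B, by positivity, fun s t hs hst ht => ?_⟩
  have h0T : (0 : ℝ) ∈ Icc 0 T := ⟨le_rfl, hT⟩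
  have hsT : s ∈ Icc 0 T := ⟨hs, hst.trans ht⟩
  have htT : t ∈ Icc 0 T := ⟨hs.trans hst, ht⟩
  have hsub : Ioc s t ⊆ Icc 0 T := fun u hu => ⟨hs.trans hu.1.le, hu.2.trans ht⟩
  have hts : 0 ≤ t - s := sub_nonneg.2 hst
  rw [intervalIntegral.integral_interval_sub_left (hb.intervalIntegrable_drift x h0T htT)
    (hb.intervalIntegrable_drift x h0T hsT)]
  have hi : IntervalIntegrable (fun s => |b₀ s|) volume s t := by
    rw [intervalIntegrable_iff_integrableOn_Ioc_of_le hst]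
    exact (h0.mono_set hsub).abs
  -- Hölder's inequality with exponent `1/α` against the constant `1` on `(s,t]` gives the power
  -- `1-α`.
  have hB : ∫ u in s..t, |b₀ u| ≤ B * (t - s) ^ (1 - α) := by
    rw [intervalIntegral.integral_of_le hst]
    have h1 : eLpNorm b₀ 1 (volume.restrict (Ioc s t)) ≤
        eLpNorm b₀ (ENNReal.ofReal (1 / α)) (volume.restrict (Icc 0 T)) *
          ENNReal.ofReal ((t - s) ^ (1 - α)) := by
      have hle : (1 : ℝ≥0∞) ≤ ENNReal.ofReal (1 / α) := by
        rw [← ENNReal.ofReal_one]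
        exact ENNReal.ofReal_le_ofReal (by linarith [hb.two_le])
      refine (eLpNorm_le_eLpNorm_mul_rpow_measure_univ hle
        (h0.mono_set hsub).aestronglyMeasurable).trans ?_
      refine mul_le_mul' (eLpNorm_mono_measure _ (Measure.restrict_mono hsub le_rfl)) ?_
      rw [Measure.restrict_apply_univ, Real.volume_Ioc, ENNReal.toReal_one,
        ENNReal.toReal_ofReal (by positivity), ENNReal.ofReal_rpow_of_nonneg hts]
      · simp
      · simp only [one_div, inv_inv, inv_one]; linarith
    have h2 := ENNReal.toReal_mono (ENNReal.mul_ne_top hLp.2.ne ENNReal.ofReal_ne_top) h1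
    rw [ENNReal.toReal_mul, ENNReal.toReal_ofReal (by positivity), eLpNorm_one_eq_lintegral_enorm,
      ← integral_norm_eq_lintegral_enorm (h0.mono_set hsub).aestronglyMeasurable] at h2
    exact h2
  calc _ ≤ ∫ u in s..t, (l * ‖x‖ + |b₀ u|) := by
        refine intervalIntegral.norm_integral_le_of_norm_le hst ?_
          (intervalIntegrable_const.add hi)
        refine Filter.Eventually.of_forall fun u hu => (hg u (hsub hu) x).trans ?_
        gcongr
        exact supUpTo_le (norm_nonneg _) fun s _ => x.norm_coe_le_norm s
    _ = l * ‖x‖ * (t - s) + ∫ u in s..t, |b₀ u| := by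
        rw [intervalIntegral.integral_add intervalIntegrable_const hi]
        rw [intervalIntegral.integral_const, smul_eq_mul, mul_comm (t - s)]
    _ ≤ l * ‖x‖ * (T ^ α * (t - s) ^ (1 - α)) + B * (t - s) ^ (1 - α) := by
        gcongr
        calc t - s = (t - s) ^ α * (t - s) ^ (1 - α) := by
              rw [← Real.rpow_add' hts (by simp)]; simp
          _ ≤ _ := by gcongr; linarith
    _ = _ := by ring

end Forced

/-! ### Hölder functions -/

section Holder

variable {E : Type*} [NormedAddCommGroup E] {a b μ : ℝ} {f : ℝ → E}

lemma MemHolder.exists_norm_sub_le (hf : MemHolder μ a b f) :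
    ∃ C, 0 ≤ C ∧ ∀ s ∈ Icc a b, ∀ t ∈ Icc a b, s ≤ t → ‖f t - f s‖ ≤ C * (t - s) ^ μ := by
  refine ⟨(eNormHolder μ a b f).toReal, ENNReal.toReal_nonneg, fun s hs t ht hst => ?_⟩
  rcases hst.eq_or_lt with rfl | hst
  · simpa using mul_nonneg ENNReal.toReal_nonneg (Real.rpow_nonneg le_rfl _)
  have hpos := Real.rpow_pos_of_pos (sub_pos.2 hst) μ
  have h : ‖f t - f s‖ₑ / ENNReal.ofReal ((t - s) ^ μ) ≤ eNormHolder μ a b f :=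
    le_add_left (le_iSup₂_of_le s hs (le_iSup₂_of_le t ⟨hst, ht.2⟩ le_rfl))
  rw [ENNReal.div_le_iff (by simpa using hpos) ENNReal.ofReal_ne_top] at h
  have h' := ENNReal.toReal_mono (ENNReal.mul_ne_top (ne_of_lt hf) ENNReal.ofReal_ne_top) h
  rwa [toReal_enorm, ENNReal.toReal_mul, ENNReal.toReal_ofReal hpos.le] at h'

lemma memHolder_of_norm_le {C D : ℝ} (hD : ∀ t ∈ Icc a b, ‖f t‖ ≤ D) (hC : 0 ≤ C)
    (hf : ∀ s ∈ Icc a b, ∀ t ∈ Icc a b, s ≤ t → ‖f t - f s‖ ≤ C * (t - s) ^ μ) :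
    MemHolder μ a b f := by
  refine lt_of_le_of_lt (add_le_add (b := ENNReal.ofReal D) (d := ENNReal.ofReal C)
    (iSup₂_le fun t ht => ?_) (iSup₂_le fun s hs => iSup₂_le fun t ht => ?_)) (by finiteness)
  · rw [← ofReal_norm]
    exact ENNReal.ofReal_le_ofReal (hD t ht)
  · refine ENNReal.div_le_of_le_mul ?_
    rw [← ofReal_norm, ← ENNReal.ofReal_mul hC]
    exact ENNReal.ofReal_le_ofReal (hf s hs t ⟨hs.1.trans ht.1.le, ht.2⟩ ht.1.le)

/-- An exponent `μ > α` makes the singularity `(t-s)^{μ-α-1}` integrable. -/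
lemma memW_of_norm_le [MeasurableSpace E] {α C D : ℝ} (hμ : α < μ)
    (hm : Measurable fun t : Icc a b => f t) (hD : ∀ t ∈ Icc a b, ‖f t‖ ≤ D) (hC : 0 ≤ C)
    (hf : ∀ s ∈ Icc a b, ∀ t ∈ Icc a b, s ≤ t → ‖f t - f s‖ ≤ C * (t - s) ^ μ) :
    MemW α a b f := by
  refine ⟨hm, lt_of_le_of_lt (b := ENNReal.ofReal D + ENNReal.ofReal C *
    ENNReal.ofReal ((b - a) ^ (μ - α) / (μ - α)))
    (iSup₂_le fun t ht => add_le_add ?_ ?_) (by finiteness)⟩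
  · rw [← ofReal_norm]
    exact ENNReal.ofReal_le_ofReal (hD t ht)
  · have hμα := sub_pos.2 hμ
    calc _ ≤ ∫⁻ s in Ioo a t, ENNReal.ofReal C * ENNReal.ofReal ((t - s) ^ (μ - α - 1)) := by
          refine setLIntegral_mono' measurableSet_Ioo fun s hs => ?_
          have hts := sub_pos.2 hs.2
          rw [← ofReal_norm, ← ENNReal.ofReal_div_of_pos (Real.rpow_pos_of_pos hts _),
            ← ENNReal.ofReal_mul hC]
          refine ENNReal.ofReal_le_ofReal ?_
          rw [div_le_iff₀ (Real.rpow_pos_of_pos hts _), mul_assoc, ← Real.rpow_add hts]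
          refine (hf s ⟨hs.1.le, hs.2.le.trans ht.2⟩ t ht hs.2.le).trans (le_of_eq ?_)
          congr 2; ring
      _ ≤ _ := by
          rw [lintegral_const_mul' _ _ ENNReal.ofReal_ne_top,
            setLIntegral_Ioo_sub_left_rpow hμα ht.1]
          have := sub_nonneg.2 ht.1
          have := ht.2
          gcongr

end Holder

lemma MemWT.apply {α T : ℝ} {m : ℕ} {g : ℝ → EuclideanSpace ℝ (Fin m)} (hg : MemWT α T g)
    (j : Fin m) : MemWT α T fun s => g s j := by
  refine ⟨(EuclideanSpace.proj (𝕜 := ℝ) j).continuous.measurable.comp hg.1,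
    lt_of_le_of_lt ?_ hg.2⟩
  have h : ∀ s t, ‖g t j - g s j‖ₑ ≤ ‖g t - g s‖ₑ := fun s t => by
    rw [← ofReal_norm, ← ofReal_norm]
    exact ENNReal.ofReal_le_ofReal (PiLp.norm_apply_le (g t - g s) j)
  unfold eNormWT
  gcongr with s hs t ht u
  · exact h s t
  · exact h s _

/-! ### The diffusion integral -/

section Diffusion

variable {d m : ℕ} {r T α β δ : ℝ}
  {σ : ℝ → EuclideanSpace ℝ (Fin d) → EuclideanSpace ℝ (Fin d × Fin m)}
  {g : ℝ → EuclideanSpace ℝ (Fin m)} {η : ℝ → EuclideanSpace ℝ (Fin d)}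

/-- The diffusion integral `∫_0^t σ(s,x(s-r)) dg_s`. -/
def diffusionIntegral (h : -r ≤ T) (α : ℝ)
    (σ : ℝ → EuclideanSpace ℝ (Fin d) → EuclideanSpace ℝ (Fin d × Fin m))
    (g : ℝ → EuclideanSpace ℝ (Fin m)) (x : C(Icc (-r) T, EuclideanSpace ℝ (Fin d))) (t : ℝ) :
    EuclideanSpace ℝ (Fin d) :=
  WithLp.toLp 2 fun i => ∑ j : Fin m,
    stieltjesTo α T (fun s => σ s (IccExtend h x (s - r)) (i, j)) (fun s => g s j) t

/-- The path `x` is Hölder of order `1 - α`. -/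
def HolderPath (h : -r ≤ T) (α : ℝ) (x : C(Icc (-r) T, EuclideanSpace ℝ (Fin d))) : Prop :=
  ∃ C, 0 ≤ C ∧ ∀ s ∈ Icc (-r) T, ∀ t ∈ Icc (-r) T, s ≤ t →
    ‖IccExtend h x t - IccExtend h x s‖ ≤ C * (t - s) ^ (1 - α)

lemma rpow_le_mul_rpow {u β γ : ℝ} (hu : 0 ≤ u) (huT : u ≤ T) (hγ : γ ≤ β) (hβ : 0 < β) :
    u ^ β ≤ T ^ (β - γ) * u ^ γ := by
  calc u ^ β = u ^ (β - γ) * u ^ γ := by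
        rw [← Real.rpow_add' hu (by simpa using hβ.ne')]; simp
    _ ≤ _ := by
        have := sub_nonneg.2 hγ
        gcongr

lemma measurable_coefficient (h : -r ≤ T) (hσ : HypH1 T β δ σ)
    (x : C(Icc (-r) T, EuclideanSpace ℝ (Fin d))) (i : Fin d) (j : Fin m) :
    Measurable fun s : Icc 0 T => σ s (IccExtend h x (s - r)) (i, j) := by
  have hc : Continuous fun s : Icc 0 T => IccExtend h x ((s : ℝ) - r) :=
    (x.continuous.Icc_extend' (h := h)).comp (by fun_prop)
  exact (EuclideanSpace.proj (𝕜 := ℝ) (i, j)).continuous.measurable.comp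
    (hσ.measurable.comp (measurable_id.prodMk hc.measurable))

lemma exists_coefficient_holder (h : -r ≤ T) (hr : 0 ≤ r) (hT : 0 ≤ T) (hα : 0 < α)
    (hα2 : α < 1 / 2) (hαβ : α < β) (hσ : HypH1 T β δ σ)
    {x : C(Icc (-r) T, EuclideanSpace ℝ (Fin d))} (hx : HolderPath h α x)
    (i : Fin d) (j : Fin m) :
    ∃ γ K : ℝ, α < γ ∧ (∀ t ∈ Icc 0 T, |σ t (IccExtend h x (t - r)) (i, j)| ≤ K) ∧
      ∀ t ∈ Icc 0 T, ∀ s ∈ Icc 0 T, s ≤ t →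
        |σ t (IccExtend h x (t - r)) (i, j) - σ s (IccExtend h x (s - r)) (i, j)| ≤
          K * (t - s) ^ γ := by
  obtain ⟨C, hC, hxC⟩ := hx
  obtain ⟨M, hM, hM1, -, hM3⟩ := hσ.bounds
  have hM0 := (hM 0 le_rfl).le
  -- `β` is the regularity of `σ` in time, `1-α` that of the path seen through the Lipschitz map `σ
  -- t`. Both exceed `α`, by `α < β` and `α < 1/2`.
  set γ := min β (1 - α)
  have hγ : α < γ := lt_min hαβ (by linarith)
  have hγ1 : γ ≤ β := min_le_left _ _
  have hγ2 : γ ≤ 1 - α := min_le_right _ _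
  set A := M 0 * (C * T ^ (1 - α - γ)) + M 0 * T ^ (β - γ)
  have hA : 0 ≤ A := by positivity
  set F := fun t => σ t (IccExtend h x (t - r)) (i, j)
  have key : ∀ t ∈ Icc 0 T, ∀ s ∈ Icc 0 T, s ≤ t → |F t - F s| ≤ A * (t - s) ^ γ := by
    intro t ht s hs hst
    have hts := sub_nonneg.2 hst
    have htsT : t - s ≤ T := by linarith [ht.2, hs.1]
    have h1 := hM1 t ht (IccExtend h x (t - r)) (IccExtend h x (s - r))
    have h2 : ‖σ t (IccExtend h x (s - r)) - σ s (IccExtend h x (s - r))‖ ≤ M 0 * (t - s) ^ β := by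
      -- The time bound is stated for a coordinate direction; the row index `i` supplies one, and
      -- the derivative term is dropped.
      have := hM3 t ht s hs (IccExtend h x (s - r)) i
      rw [abs_of_nonneg hts] at this
      exact le_trans (le_add_of_nonneg_right (norm_nonneg _)) this
    have h3 := hxC (s - r) ⟨by linarith [hs.1], by linarith [hs.2]⟩ (t - r)
      ⟨by linarith [ht.1], by linarith [ht.2]⟩ (by linarith)
    rw [sub_sub_sub_cancel_right] at h3
    calc |F t - F s| ≤ ‖σ t (IccExtend h x (t - r)) - σ s (IccExtend h x (s - r))‖ :=
          PiLp.norm_apply_le (σ t (IccExtend h x (t - r)) - σ s (IccExtend h x (s - r))) (i, j)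
      _ ≤ ‖σ t (IccExtend h x (t - r)) - σ t (IccExtend h x (s - r))‖ +
          ‖σ t (IccExtend h x (s - r)) - σ s (IccExtend h x (s - r))‖ :=
            norm_sub_le_norm_sub_add_norm_sub _ _ _
      _ ≤ M 0 * (C * (T ^ (1 - α - γ) * (t - s) ^ γ)) + M 0 * (T ^ (β - γ) * (t - s) ^ γ) := by
          refine add_le_add (h1.trans ?_) (h2.trans ?_)
          · refine mul_le_mul_of_nonneg_left (h3.trans ?_) hM0
            exact mul_le_mul_of_nonneg_left (rpow_le_mul_rpow hts htsT hγ2 (by linarith)) hC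
          · exact mul_le_mul_of_nonneg_left
              (rpow_le_mul_rpow hts htsT hγ1 (by linarith)) hM0
      _ = _ := by ring
  refine ⟨γ, |F 0| + A * T ^ γ + A, hγ, fun t ht => ?_, fun t ht s hs hst => ?_⟩
  · have h1 := key t ht 0 ⟨le_rfl, hT⟩ ht.1
    have h2 : A * (t - 0) ^ γ ≤ A * T ^ γ := by
      have := ht.1
      have := ht.2
      rw [sub_zero]
      gcongr
      linarith
    have h3 := abs_sub_abs_le_abs_sub (F t) (F 0)
    change |F t| ≤ _
    linarith
  · refine (key t ht s hs hst).trans ?_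
    have := sub_nonneg.2 hst
    have : 0 ≤ |F 0| + A * T ^ γ := by positivity
    gcongr
    linarith

lemma diffusionIntegral_zero (h : -r ≤ T) (x : C(Icc (-r) T, EuclideanSpace ℝ (Fin d))) :
    diffusionIntegral h α σ g x 0 = 0 := by
  ext i
  simp [diffusionIntegral, stieltjesTo_zero]

lemma exists_norm_diffusionIntegral_sub_le (h : -r ≤ T) (hr : 0 ≤ r) (hT : 0 ≤ T) (hα : 0 < α)
    (hα2 : α < 1 / 2) (hαβ : α < β) (hσ : HypH1 T β δ σ) (hg : MemWT α T g)
    {x : C(Icc (-r) T, EuclideanSpace ℝ (Fin d))} (hx : HolderPath h α x) :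
    ∃ C, 0 ≤ C ∧ ∀ s t, 0 ≤ s → s ≤ t → t ≤ T →
      ‖diffusionIntegral h α σ g x t - diffusionIntegral h α σ g x s‖ ≤
        C * (t - s) ^ (1 - α) := by
  have hij : ∀ (i : Fin d) (j : Fin m), ∃ C, 0 ≤ C ∧ ∀ s t, 0 ≤ s → s ≤ t → t ≤ T →
      |stieltjesTo α T (fun s => σ s (IccExtend h x (s - r)) (i, j)) (fun s => g s j) t -
        stieltjesTo α T (fun s => σ s (IccExtend h x (s - r)) (i, j)) (fun s => g s j) s| ≤
        C * (t - s) ^ (1 - α) := by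
    intro i j
    obtain ⟨γ, K, hγ, h1, h2⟩ := exists_coefficient_holder h hr hT hα hα2 hαβ hσ hx i j
    exact exists_abs_stieltjesTo_sub_le hα (by linarith) hγ hT (hg.apply j)
      (measurable_coefficient h hσ x i j) h1 h2
  choose C hC hle using hij
  -- `Λ` is the identity from the sup norm to the Euclidean norm; its operator norm turns entrywise
  -- bounds into a vector bound.
  let Λ := ((EuclideanSpace.equiv (Fin d) ℝ).symm : (Fin d → ℝ) →L[ℝ] EuclideanSpace ℝ (Fin d))
  refine ⟨‖Λ‖ * ∑ i, ∑ j, C i j,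
    mul_nonneg (norm_nonneg _) (Finset.sum_nonneg fun i _ => Finset.sum_nonneg fun j _ => hC i j),
    fun s t hs hst ht => ?_⟩
  have hts := Real.rpow_nonneg (sub_nonneg.2 hst) (1 - α)
  have hrw : diffusionIntegral h α σ g x t - diffusionIntegral h α σ g x s =
      Λ (fun i => ∑ j, (stieltjesTo α T (fun s => σ s (IccExtend h x (s - r)) (i, j))
          (fun s => g s j) t -
        stieltjesTo α T (fun s => σ s (IccExtend h x (s - r)) (i, j)) (fun s => g s j) s)) := by
    ext i
    simp [diffusionIntegral, Λ, EuclideanSpace.equiv]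
  rw [hrw, mul_assoc]
  refine (Λ.le_opNorm _).trans (mul_le_mul_of_nonneg_left ?_ (norm_nonneg _))
  refine (pi_norm_le_iff_of_nonneg (mul_nonneg (Finset.sum_nonneg fun i _ =>
    Finset.sum_nonneg fun j _ => hC i j) hts)).2 fun i => ?_
  refine (norm_sum_le _ _).trans ((Finset.sum_le_sum fun j _ => hle i j s t hs hst ht).trans ?_)
  rw [← Finset.sum_mul]
  refine mul_le_mul_of_nonneg_right ?_ hts
  exact Finset.single_le_sum (f := fun i => ∑ j, C i j)
    (fun i _ => Finset.sum_nonneg fun j _ => hC i j) (Finset.mem_univ i)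

/-- Here the delay acts: for `s < t` the integrand reads the path at `s - r < t - r ≤ τ`, so
agreement up to `τ` is worth an extra `r`. -/
lemma diffusionIntegral_congr (h : -r ≤ T) {τ t : ℝ} (ht : t ≤ T) (hτ : t ≤ τ + r) (hr : 0 ≤ r)
    {x y : C(Icc (-r) T, EuclideanSpace ℝ (Fin d))}
    (hxy : ∀ s : Icc (-r) T, (s : ℝ) ≤ τ → x s = y s) :
    diffusionIntegral h α σ g x t = diffusionIntegral h α σ g y t := by
  have key : ∀ (i : Fin d) (j : Fin m),
      (Ioo 0 t).indicator (fun s => σ s (IccExtend h x (s - r)) (i, j)) =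
        (Ioo 0 t).indicator (fun s => σ s (IccExtend h y (s - r)) (i, j)) := by
    intro i j
    refine indicator_congr fun s hs => ?_
    have hs' : s - r ∈ Icc (-r) T := ⟨by linarith [hs.1], by linarith [hs.2]⟩
    rw [IccExtend_of_mem h x hs', IccExtend_of_mem h y hs',
      hxy ⟨s - r, hs'⟩ (by simp only; linarith [hs.2])]
  simp only [diffusionIntegral, stieltjesTo, key]

end Diffusion

/-! ### The delay equation -/

section Delay

variable {d m : ℕ} {r T α β δ : ℝ}
  {b : ℝ → C(Icc (-r) T, EuclideanSpace ℝ (Fin d)) → EuclideanSpace ℝ (Fin d)}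
  {σ : ℝ → EuclideanSpace ℝ (Fin d) → EuclideanSpace ℝ (Fin d × Fin m)}
  {g : ℝ → EuclideanSpace ℝ (Fin m)} {η : ℝ → EuclideanSpace ℝ (Fin d)}

/-- The sum of the initial path, frozen after time `0`, and the diffusion integral. -/
def forcing (h : -r ≤ T) (α : ℝ)
    (σ : ℝ → EuclideanSpace ℝ (Fin d) → EuclideanSpace ℝ (Fin d × Fin m))
    (g : ℝ → EuclideanSpace ℝ (Fin m)) (η : ℝ → EuclideanSpace ℝ (Fin d))
    (x : C(Icc (-r) T, EuclideanSpace ℝ (Fin d))) (t : ℝ) : EuclideanSpace ℝ (Fin d) :=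
  η (min t 0) + diffusionIntegral h α σ g x (max t 0)

lemma forcing_of_nonpos (h : -r ≤ T) (x : C(Icc (-r) T, EuclideanSpace ℝ (Fin d))) {t : ℝ}
    (ht : t ≤ 0) : forcing h α σ g η x t = η t := by
  rw [forcing, min_eq_left ht, max_eq_right ht, diffusionIntegral_zero, add_zero]

lemma driftIntegral_of_nonpos (x : C(Icc (-r) T, EuclideanSpace ℝ (Fin d))) {t : ℝ}
    (ht : t ≤ 0) : driftIntegral b x t = 0 := by
  rw [driftIntegral, max_eq_right ht, intervalIntegral.integral_same]

lemma forcing_congr (h : -r ≤ T) (hr : 0 ≤ r) {τ : ℝ}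
    {x y : C(Icc (-r) T, EuclideanSpace ℝ (Fin d))}
    (hxy : ∀ s : Icc (-r) T, (s : ℝ) ≤ τ → x s = y s) {t : ℝ} (ht : t ≤ T) (htτ : t ≤ τ + r) :
    forcing h α σ g η x t = forcing h α σ g η y t := by
  rcases le_total t 0 with h0 | h0
  · rw [forcing_of_nonpos h x h0, forcing_of_nonpos h y h0]
  · unfold forcing
    rw [max_eq_left h0, diffusionIntegral_congr h ht htτ hr hxy]

/-- Freezing times at `0` merges the initial condition and the integral equation into one identity
on `[-r,T]`, to which the forced equation applies. -/
lemma IsSolution.eq_forcing {h : -r ≤ T} {x : C(Icc (-r) T, EuclideanSpace ℝ (Fin d))}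
    (hx : IsSolution h α b σ g η x) (t : Icc (-r) T) :
    x t = forcing h α σ g η x t + driftIntegral b x t := by
  have hxt : x t = IccExtend h x t := (IccExtend_val h x t).symm
  rcases le_or_gt (t : ℝ) 0 with h0 | h0
  · rw [forcing_of_nonpos h x h0, driftIntegral_of_nonpos x h0, add_zero, hxt]
    exact hx.initial t ⟨t.2.1, h0⟩
  · rw [hxt, hx.equation t ⟨h0, t.2.2⟩, forcing, driftIntegral, min_eq_right h0.le,
      max_eq_left h0.le, add_right_comm]
    rfl

lemma isSolution_of_eq_forcing (h : -r ≤ T) (hr : 0 ≤ r) (hT : 0 ≤ T) (hα : 0 < α)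
    (hα2 : α < 1 / 2) (hαβ : α < β) (hσ : HypH1 T β δ σ) (hb : HypH2 r T (1 / α) b)
    {x : C(Icc (-r) T, EuclideanSpace ℝ (Fin d))} (hx : HolderPath h α x)
    (heq : ∀ t : Icc (-r) T, x t = forcing h α σ g η x t + driftIntegral b x t) :
    IsSolution h α b σ g η x where
  integrable_drift := hb.integrableOn_drift x
  memW1_diffusion t ht i j := by
    obtain ⟨γ, K, hγ, h1, h2⟩ := exists_coefficient_holder h hr hT hα hα2 hαβ hσ hx i j
    exact memW1_indicator hα (by linarith) hγ (measurable_coefficient h hσ x i j) h1 h2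
      ⟨ht.1.le, ht.2⟩
  equation t ht := by
    have htT : t ∈ Icc (-r) T := ⟨by linarith [ht.1], ht.2⟩
    rw [IccExtend_of_mem h x htT, heq, forcing, driftIntegral, min_eq_right ht.1.le,
      max_eq_left ht.1.le, add_right_comm]
    rfl
  initial t ht := by
    have htT : t ∈ Icc (-r) T := ⟨ht.1, by linarith [ht.2]⟩
    rw [IccExtend_of_mem h x htT, heq, forcing_of_nonpos h x ht.2, driftIntegral_of_nonpos x ht.2,
      add_zero]

lemma min_sub_min_le {s t : ℝ} (hst : s ≤ t) : min t 0 - min s 0 ≤ t - s := by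
  rcases le_total t 0 with h | h <;> rcases le_total s 0 with h' | h' <;> (simp [*]; try linarith)

lemma max_sub_max_le {s t : ℝ} (hst : s ≤ t) : max t 0 - max s 0 ≤ t - s := by
  rcases le_total t 0 with h | h <;> rcases le_total s 0 with h' | h' <;> (simp [*]; try linarith)

/-- Freezing the time variable is nonexpansive, so it preserves the Hölder constant. -/
lemma exists_norm_sub_comp_min_le (hr : 0 ≤ r) (hα1 : α < 1)
    (hη : MemHolder (1 - α) (-r) 0 η) :
    ∃ C, 0 ≤ C ∧ ∀ s t, -r ≤ s → s ≤ t →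
      ‖η (min t 0) - η (min s 0)‖ ≤ C * (t - s) ^ (1 - α) := by
  obtain ⟨C, hC, h⟩ := hη.exists_norm_sub_le
  refine ⟨C, hC, fun s t hs hst => ?_⟩
  have hm : min s 0 ≤ min t 0 := min_le_min_right 0 hst
  have h1 : ∀ t, -r ≤ t → min t 0 ∈ Icc (-r) 0 := fun t ht =>
    ⟨le_min ht (by linarith), min_le_right _ _⟩
  refine (h _ (h1 s hs) _ (h1 t (hs.trans hst)) hm).trans ?_
  have := sub_nonneg.2 hm
  have := sub_pos.2 hα1
  have := min_sub_min_le hst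
  gcongr

lemma norm_sub_comp_max_le {f : ℝ → EuclideanSpace ℝ (Fin d)} {C : ℝ} (hT : 0 ≤ T) (hα1 : α < 1)
    (hC : 0 ≤ C)
    (hf : ∀ s t, 0 ≤ s → s ≤ t → t ≤ T → ‖f t - f s‖ ≤ C * (t - s) ^ (1 - α)) {s t : ℝ}
    (hst : s ≤ t) (ht : t ≤ T) : ‖f (max t 0) - f (max s 0)‖ ≤ C * (t - s) ^ (1 - α) := by
  have hm : max s 0 ≤ max t 0 := max_le_max_right 0 hst
  refine (hf _ _ (le_max_right _ _) hm (max_le ht hT)).trans ?_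
  have := sub_nonneg.2 hm
  have := sub_pos.2 hα1
  have := max_sub_max_le hst
  gcongr

/-- The solution of the forced equation, with the diffusion evaluated along a Hölder path, exists
and is a Hölder path. -/
lemma exists_holderPath_forcing (h : -r ≤ T) (hr : 0 ≤ r) (hT : 0 ≤ T) (hα : 0 < α)
    (hα2 : α < 1 / 2) (hαβ : α < β) (hσ : HypH1 T β δ σ) (hb : HypH2 r T (1 / α) b)
    (hg : MemWT α T g) (hη : MemHolder (1 - α) (-r) 0 η)
    {x : C(Icc (-r) T, EuclideanSpace ℝ (Fin d))} (hx : HolderPath h α x) :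
    ∃ y, HolderPath h α y ∧
      ∀ t : Icc (-r) T, y t = forcing h α σ g η x t + driftIntegral b y t := by
  have hα1 : α < 1 := by linarith
  obtain ⟨C₁, hC₁, h₁⟩ := exists_norm_sub_comp_min_le hr hα1 hη
  obtain ⟨C₂, hC₂, h₂⟩ := exists_norm_diffusionIntegral_sub_le h hr hT hα hα2 hαβ hσ hg hx
  have hF : ∀ s ∈ Icc (-r) T, ∀ t ∈ Icc (-r) T, s ≤ t →
      ‖forcing h α σ g η x t - forcing h α σ g η x s‖ ≤ (C₁ + C₂) * (t - s) ^ (1 - α) := by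
    intro s hs t ht hst
    unfold forcing
    rw [add_sub_add_comm, add_mul]
    exact (norm_add_le _ _).trans (add_le_add (h₁ s t hs.1 hst)
      (norm_sub_comp_max_le hT hα1 hC₂ h₂ hst ht.2))
  have hcont := (uniformContinuousOn_of_norm_sub_le (sub_pos.2 hα1)
    (add_nonneg hC₁ hC₂) hF).continuousOn
  obtain ⟨y, hy⟩ := hb.exists_forced hT ⟨fun t : Icc (-r) T => forcing h α σ g η x t,
    continuousOn_iff_continuous_domRestrict.1 hcont⟩
  obtain ⟨C₃, hC₃, h₃⟩ := hb.exists_norm_integral_drift_le hα hα1 hT y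
  refine ⟨y, ⟨C₁ + C₂ + C₃, by positivity, fun s hs t ht hst => ?_⟩, hy⟩
  rw [IccExtend_of_mem h y hs, IccExtend_of_mem h y ht, hy, hy, add_sub_add_comm, add_mul]
  exact (norm_add_le _ _).trans (add_le_add (hF s hs t ht hst)
    (norm_sub_comp_max_le hT hα1 hC₃ h₃ hst ht.2))

/-- Method of steps without gluing: each stage produces a Hölder path on all of `[-r,T]` that
satisfies the equation only up to `kr`. -/
lemma exists_holderPath_solution (h : -r ≤ T) (hr : 0 < r) (hT : 0 ≤ T) (hα : 0 < α)
    (hα2 : α < 1 / 2) (hαβ : α < β) (hσ : HypH1 T β δ σ) (hb : HypH2 r T (1 / α) b)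
    (hg : MemWT α T g) (hη : MemHolder (1 - α) (-r) 0 η) :
    ∃ x, HolderPath h α x ∧
      ∀ t : Icc (-r) T, x t = forcing h α σ g η x t + driftIntegral b x t := by
  have hα1 : α < 1 := by linarith
  have key : ∀ k : ℕ, ∃ x, HolderPath h α x ∧ ∀ t : Icc (-r) T, (t : ℝ) ≤ k * r →
      x t = forcing h α σ g η x t + driftIntegral b x t := by
    intro k
    induction k with
    | zero =>
      obtain ⟨C, hC, hle⟩ := exists_norm_sub_comp_min_le hr.le hα1 hη
      have hcont : ContinuousOn (fun t => η (min t 0)) (Icc (-r) T) :=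
        (uniformContinuousOn_of_norm_sub_le (sub_pos.2 hα1) hC
          fun s hs t _ hst => hle s t hs.1 hst).continuousOn
      refine ⟨⟨fun t : Icc (-r) T => η (min t 0),
        continuousOn_iff_continuous_domRestrict.1 hcont⟩,
        ⟨C, hC, fun s hs t ht hst => ?_⟩, fun t ht => ?_⟩
      · rw [IccExtend_of_mem h _ hs, IccExtend_of_mem h _ ht]
        exact hle s t hs.1 hst
      · have h0 : (t : ℝ) ≤ 0 := by simpa using ht
        rw [forcing_of_nonpos h _ h0, driftIntegral_of_nonpos _ h0, add_zero]
        exact congrArg η (min_eq_left h0)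
    | succ k ih =>
      obtain ⟨x, hxH, hx⟩ := ih
      obtain ⟨y, hyH, hy⟩ := exists_holderPath_forcing h hr.le hT hα hα2 hαβ hσ hb hg hη hxH
      refine ⟨y, hyH, fun t ht => ?_⟩
      -- After `kr` the new path may leave the old one, but up to `kr` causal uniqueness identifies
      -- them. Their diffusion integrals then agree up to `(k+1)r`, so `y` is driven by its own past
      -- there.
      have hxy := hb.eq_of_forced hT hx (fun t _ => hy t)
      rw [← forcing_congr h hr.le hxy t.2.2 (by push_cast at ht; linarith)]
      exact hy t
  obtain ⟨k, hk⟩ := exists_nat_ge (T / r)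
  obtain ⟨x, hxH, hx⟩ := key k
  exact ⟨x, hxH, fun t => hx t (t.2.2.trans ((div_le_iff₀ hr).1 hk))⟩

/-- Agreement up to `kr` makes the forcings equal up to `(k+1)r`, and uniqueness for the forced
equation carries agreement forward. -/
lemma eq_of_eq_forcing (h : -r ≤ T) (hr : 0 < r) (hT : 0 ≤ T) {ρ : ℝ} (hb : HypH2 r T ρ b)
    {x y : C(Icc (-r) T, EuclideanSpace ℝ (Fin d))}
    (hx : ∀ t : Icc (-r) T, x t = forcing h α σ g η x t + driftIntegral b x t)
    (hy : ∀ t : Icc (-r) T, y t = forcing h α σ g η y t + driftIntegral b y t) : x = y := by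
  have key : ∀ k : ℕ, ∀ t : Icc (-r) T, (t : ℝ) ≤ k * r → x t = y t := by
    intro k
    induction k with
    | zero =>
      intro t ht
      have h0 : (t : ℝ) ≤ 0 := by simpa using ht
      rw [hx, hy, forcing_of_nonpos h _ h0, forcing_of_nonpos h _ h0, driftIntegral_of_nonpos _ h0,
        driftIntegral_of_nonpos _ h0]
    | succ k ih =>
      refine hb.eq_of_forced hT (fun t _ => hx t) fun t ht => ?_
      rw [forcing_congr h hr.le ih t.2.2 (by push_cast at ht; linarith)]
      exact hy t
  obtain ⟨k, hk⟩ := exists_nat_ge (T / r)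
  exact ContinuousMap.ext fun t => key k t (t.2.2.trans ((div_le_iff₀ hr).1 hk))

end Delay

end DelayEq

end

theorem theorem3p1 {d m : ℕ} (r T : ℝ) (hr : 0 < r) (hT : 0 < T)
    (α β δ : ℝ) (hα : 0 < α) (hα₀ : α < min (1 / 2) (min β (δ / (1 + δ))))
    (σ : ℝ → EuclideanSpace ℝ (Fin d) → EuclideanSpace ℝ (Fin d × Fin m))
    (hσ : DelayEq.HypH1 T β δ σ)
    (b : ℝ → C(Set.Icc (-r) T, EuclideanSpace ℝ (Fin d)) → EuclideanSpace ℝ (Fin d))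
    (hb : DelayEq.HypH2 r T (1 / α) b)
    (g : ℝ → EuclideanSpace ℝ (Fin m)) (hg : DelayEq.MemWT α T g)
    (η : ℝ → EuclideanSpace ℝ (Fin d))
    (hη : DelayEq.MemW α (-r) 0 η) (hη' : DelayEq.MemHolder (1 - α) (-r) 0 η) :
    ∃! x : C(Set.Icc (-r) T, EuclideanSpace ℝ (Fin d)),
      DelayEq.MemW α (-r) T (Set.IccExtend (by linarith : -r ≤ T) x) ∧
      DelayEq.MemHolder (1 - α) (-r) T (Set.IccExtend (by linarith : -r ≤ T) x) ∧
      DelayEq.IsSolution (by linarith : -r ≤ T) α b σ g η x := by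
  have h : -r ≤ T := by linarith
  have hα2 : α < 1 / 2 := hα₀.trans_le (min_le_left _ _)
  have hαβ : α < β := hα₀.trans_le ((min_le_right _ _).trans (min_le_left _ _))
  obtain ⟨x, hxH, hx⟩ :=
    DelayEq.exists_holderPath_solution h hr hT.le hα hα2 hαβ hσ hb hg hη'
  have hsol := DelayEq.isSolution_of_eq_forcing h hr.le hT.le hα hα2 hαβ hσ hb hxH hx
  obtain ⟨C, hC, hle⟩ := hxH
  have hD : ∀ t ∈ Set.Icc (-r) T, ‖Set.IccExtend h x t‖ ≤ ‖x‖ := fun t _ =>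
    x.norm_coe_le_norm _
  have hm : Measurable fun t : Set.Icc (-r) T => Set.IccExtend h x t :=
    ((x.continuous.Icc_extend' (h := h)).comp continuous_subtype_val).measurable
  -- The exponent condition is `α < 1 - α`, that is `α < 1/2`.
  refine ⟨x, ⟨DelayEq.memW_of_norm_le (by linarith) hm hD hC hle,
    DelayEq.memHolder_of_norm_le hD hC hle, hsol⟩, fun y hy => ?_⟩
  exact DelayEq.eq_of_eq_forcing h hr hT.le hb hy.2.2.eq_forcing hx
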